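/- Let a distance space be a set $X$ with a function $\rho\colon X\times X\to\mathbb{R}_{\ge 0}$ such that $\rho(x,y)=\rho(y,x)$ and $\rho(x,x)=0$ for all $x,y\in X$. It is isometrically embeddable into $\mathbb{R}^d$ if there is a (not necessarily injective) map $\varphi\colon X\to\mathbb{R}^d$ with $\rho(x,y)=\|\varphi(x)-\varphi(y)\|_2$ for all $x,y\in X$. The (weighted) problem Euclidean Embedding with Outliers is the following decision problem: given a distance space $(X,\rho)$ with $n$ points, weights $w\colon X\to\mathbb{Z}_{\ge 0}$, and integers $W,k\ge 0$ and $d\ge 1$, decide whether there is a set $O\subseteq X$ with $|O|\le k$ and $\sum_{x\in O}w(x)\le W$ such that $(X\setminus O,\rho)$ is isometrically embeddable into $\mathbb{R}^d$. Theorem. Euclidean Embedding with Outliers can be solved in time $n^{O(1)}\cdot\min\{(d+3)^k,\,2^{d+k}\}$ in the real RAM model, in which basic operations on real numbers take unit time. That is, there are a single real RAM program and a constant $c$ such that on every instance the program halts with the correct answer after at most $c\,(n+1)^c\cdot\min\{(d+3)^k,\,2^{d+k}\}$ steps. -/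

import Mathlib

/-! ## Distance spaces and Euclidean embeddings -/

/-- A distance space on `X`: a nonnegative symmetric function vanishing on the diagonal.
Neither the triangle inequality nor positivity off the diagonal is required. -/
structure DistanceSpace (X : Type*) where
  rho : X → X → ℝ
  rho_nonneg : ∀ x y, 0 ≤ rho x y
  rho_symm : ∀ x y, rho x y = rho y x
  rho_self : ∀ x, rho x x = 0

/-- The distance subspace on a set of points. -/
def DistanceSpace.restrict {X : Type*} (D : DistanceSpace X) (Y : Set X) : DistanceSpace Y where
  rho x y := D.rho x y
  rho_nonneg x y := D.rho_nonneg x y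
  rho_symm x y := D.rho_symm x y
  rho_self x := D.rho_self x

/-- Isometric embeddability into `ℝ^d` with the Euclidean norm (the map need not be injective). -/
def DistanceSpace.Embeddable {X : Type*} (D : DistanceSpace X) (d : ℕ) : Prop :=
  ∃ φ : X → EuclideanSpace ℝ (Fin d), ∀ x y, D.rho x y = ‖φ x - φ y‖

/-! ## The problem Euclidean Embedding with Outliers -/

/-- An instance of (weighted) Euclidean Embedding with Outliers on the `n` points
`0, …, n - 1`: a distance space, weights of the points, a weight budget `W`, a bound `k` on the
number of outliers, and a dimension `d ≥ 1`. -/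
structure EEOInstance where
  n : ℕ
  space : DistanceSpace (Fin n)
  weight : Fin n → ℕ
  W : ℕ
  k : ℕ
  d : ℕ
  one_le_d : 1 ≤ d

/-- Yes-instances: after the deletion of some set of at most `k` points of total weight at most
`W`, the remaining distance space embeds isometrically into `ℝ^d`. -/
def EEOInstance.IsYes (I : EEOInstance) : Prop :=
  ∃ O : Finset (Fin I.n), O.card ≤ I.k ∧ ∑ x ∈ O, I.weight x ≤ I.W ∧
    (I.space.restrict {x | x ∉ O}).Embeddable I.d

/-! ## The real RAM

The memory consists of two infinite arrays of cells, one for natural numbers and one for real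
numbers, both addressed by natural numbers.  Natural numbers can be added, subtracted (truncated
at zero) and compared; real numbers can be added, subtracted, multiplied, divided and compared.
There is no rounding and no conversion of reals to integers, and the constants in programs are
natural numbers.  Addresses may be computed (indirect addressing).  Programs are finite while
programs.  Every arithmetic operation, constant, memory access, comparison, boolean connective,
assignment and branching costs one unit of time. -/

namespace RealRAM

/-- Memory contents. -/
structure State where
  int : ℕ → ℕ
  real : ℕ → ℝ

/-- Natural number expressions; `load a` is the content of the integer cell with address `a`. -/
inductive IExp where
  | const (c : ℕ)
  | load (a : IExp)
  | add (a b : IExp)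
  | sub (a b : IExp)

/-- Value of a natural number expression (subtraction is truncated at zero). -/
def IExp.eval (s : State) : IExp → ℕ
  | .const c => c
  | .load a => s.int (a.eval s)
  | .add a b => a.eval s + b.eval s
  | .sub a b => a.eval s - b.eval s

/-- Time to evaluate a natural number expression. -/
def IExp.cost : IExp → ℕ
  | .const _ => 1
  | .load a => a.cost + 1
  | .add a b => a.cost + b.cost + 1
  | .sub a b => a.cost + b.cost + 1

/-- Real number expressions; `load a` is the content of the real cell with address `a`. -/
inductive RExp where
  | const (c : ℕ)
  | load (a : IExp)
  | add (a b : RExp)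
  | sub (a b : RExp)
  | mul (a b : RExp)
  | div (a b : RExp)

/-- Value of a real number expression (the result of a division by zero is zero). -/
noncomputable def RExp.eval (s : State) : RExp → ℝ
  | .const c => (c : ℝ)
  | .load a => s.real (a.eval s)
  | .add a b => a.eval s + b.eval s
  | .sub a b => a.eval s - b.eval s
  | .mul a b => a.eval s * b.eval s
  | .div a b => a.eval s / b.eval s

/-- Time to evaluate a real number expression. -/
def RExp.cost : RExp → ℕ
  | .const _ => 1
  | .load a => a.cost + 1
  | .add a b => a.cost + b.cost + 1
  | .sub a b => a.cost + b.cost + 1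
  | .mul a b => a.cost + b.cost + 1
  | .div a b => a.cost + b.cost + 1

/-- Tests: comparisons of naturals and of reals, and their boolean combinations. -/
inductive Test where
  | ile (a b : IExp)
  | rle (a b : RExp)
  | not (p : Test)
  | and (p q : Test)

/-- Truth of a test. -/
def Test.Holds (s : State) : Test → Prop
  | .ile a b => a.eval s ≤ b.eval s
  | .rle a b => a.eval s ≤ b.eval s
  | .not p => ¬ p.Holds s
  | .and p q => p.Holds s ∧ q.Holds s

/-- Time to evaluate a test. -/
def Test.cost : Test → ℕ
  | .ile a b => a.cost + b.cost + 1
  | .rle a b => a.cost + b.cost + 1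
  | .not p => p.cost + 1
  | .and p q => p.cost + q.cost + 1

/-- Programs. `istore a e` and `rstore a e` write the value of `e` into the integer cell,
respectively the real cell, with address `a`; `loop b p` is "while `b` do `p`". -/
inductive Prog where
  | skip
  | istore (a e : IExp)
  | rstore (a : IExp) (e : RExp)
  | seq (p q : Prog)
  | ite (b : Test) (p q : Prog)
  | loop (b : Test) (p : Prog)

/-- `Exec p s t s'`: started with memory `s`, the program `p` halts after exactly `t` units of
time with memory `s'`. -/
inductive Exec : Prog → State → ℕ → State → Prop where
  | skip (s : State) : Exec .skip s 1 s
  | istore (a e : IExp) (s : State) :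
      Exec (.istore a e) s (a.cost + e.cost + 1)
        { s with int := Function.update s.int (a.eval s) (e.eval s) }
  | rstore (a : IExp) (e : RExp) (s : State) :
      Exec (.rstore a e) s (a.cost + e.cost + 1)
        { s with real := Function.update s.real (a.eval s) (e.eval s) }
  | seq {p q : Prog} {s₀ s₁ s₂ : State} {t₁ t₂ : ℕ} :
      Exec p s₀ t₁ s₁ → Exec q s₁ t₂ s₂ → Exec (.seq p q) s₀ (t₁ + t₂) s₂
  | ite_true {b : Test} {p q : Prog} {s₀ s₁ : State} {t : ℕ} :
      b.Holds s₀ → Exec p s₀ t s₁ → Exec (.ite b p q) s₀ (b.cost + 1 + t) s₁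
  | ite_false {b : Test} {p q : Prog} {s₀ s₁ : State} {t : ℕ} :
      ¬ b.Holds s₀ → Exec q s₀ t s₁ → Exec (.ite b p q) s₀ (b.cost + 1 + t) s₁
  | loop_done {b : Test} {p : Prog} {s : State} :
      ¬ b.Holds s → Exec (.loop b p) s (b.cost + 1) s
  | loop_step {b : Test} {p : Prog} {s₀ s₁ s₂ : State} {t₁ t₂ : ℕ} :
      b.Holds s₀ → Exec p s₀ t₁ s₁ → Exec (.loop b p) s₁ t₂ s₂ →
        Exec (.loop b p) s₀ (b.cost + 1 + t₁ + t₂) s₂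

/-- The machine is deterministic: running time and final memory are determined by the program
and the initial memory. -/
theorem Exec.unique {p : Prog} {s s₁ s₂ : State} {t₁ t₂ : ℕ}
    (h₁ : Exec p s t₁ s₁) (h₂ : Exec p s t₂ s₂) : t₁ = t₂ ∧ s₁ = s₂ := by
  induction h₁ generalizing t₂ s₂ with
  | skip s => cases h₂; exact ⟨rfl, rfl⟩
  | istore a e s => cases h₂; exact ⟨rfl, rfl⟩
  | rstore a e s => cases h₂; exact ⟨rfl, rfl⟩
  | seq _ _ ih₁ ih₂ =>
    cases h₂ with
    | seq g₁ g₂ =>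
      obtain ⟨rfl, rfl⟩ := ih₁ g₁
      obtain ⟨rfl, rfl⟩ := ih₂ g₂
      exact ⟨rfl, rfl⟩
  | ite_true hb _ ih =>
    cases h₂ with
    | ite_true _ g => obtain ⟨rfl, rfl⟩ := ih g; exact ⟨rfl, rfl⟩
    | ite_false hb' _ => exact absurd hb hb'
  | ite_false hb _ ih =>
    cases h₂ with
    | ite_true hb' _ => exact absurd hb' hb
    | ite_false _ g => obtain ⟨rfl, rfl⟩ := ih g; exact ⟨rfl, rfl⟩
  | loop_done hb =>
    cases h₂ with
    | loop_done _ => exact ⟨rfl, rfl⟩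
    | loop_step hb' _ _ => exact absurd hb' hb
  | loop_step hb _ _ ih₁ ih₂ =>
    cases h₂ with
    | loop_done hb' => exact absurd hb hb'
    | loop_step _ g₁ g₂ =>
      obtain ⟨rfl, rfl⟩ := ih₁ g₁
      obtain ⟨rfl, rfl⟩ := ih₂ g₂
      exact ⟨rfl, rfl⟩

end RealRAM

/-- The initial memory for an instance: the integer cells `0, 1, 2, 3` hold `n, k, d, W`, the
integer cell `4 + i` holds the weight of the point `i`, the real cell `i * n + j` holds the
distance of the points `i` and `j`, and all other cells hold zero. -/
def EEOInstance.encode (I : EEOInstance) : RealRAM.State where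
  int := fun a =>
    if a = 0 then I.n
    else if a = 1 then I.k
    else if a = 2 then I.d
    else if a = 3 then I.W
    else if h : a - 4 < I.n then I.weight ⟨a - 4, h⟩
    else 0
  real := fun a =>
    if h : a / I.n < I.n ∧ a % I.n < I.n then I.space.rho ⟨a / I.n, h.1⟩ ⟨a % I.n, h.2⟩
    else 0

/-- On input `I`, the program halts within `T` units of time, and the final content of the integer
cell `0` is the correct answer: `1` for a yes-instance and `0` for a no-instance. -/
def RealRAM.Prog.SolvesWithin (P : RealRAM.Prog) (I : EEOInstance) (T : ℕ) : Prop :=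
  ∃ (t : ℕ) (s : RealRAM.State), RealRAM.Exec P I.encode t s ∧ t ≤ T ∧
    (I.IsYes → s.int 0 = 1) ∧ (¬ I.IsYes → s.int 0 = 0)

/-!
A bounded search tree solves the problem, with Gaussian elimination on a Gram matrix as its only
geometric ingredient.

Fix a set of deleted points. Take the first alive point `b` as origin; in an embedding the inner
products of the vectors `x - b` are `(ρ(b,x)² + ρ(b,y)² - ρ(x,y)²) / 2`. Run through the points in
order, and eliminate with an alive point `p` as pivot whenever its diagonal entry is positive and
at most `d` points (`b` included) have been chosen. If the residual matrix vanishes on the alive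
points, then the eliminated columns are coordinates and the alive points embed into `ℝ^d`
(`embedding_of_res_eq_zero`). If it has a nonzero entry at `x, y`, then the at most `d + 1` pivots
together with `x` and `y` do not embed: elimination is the Gram-Schmidt process, whose residual
vectors in an embedding would all be zero (`res_eq_zero_of_embedding`). So every solution deletes
one of at most `d + 3` points, and the tree branches on the first of them that it deletes: the
child that deletes the pivot number `i` keeps the pivots before it, and the children that delete
`x` or `y` keep all pivots. It suffices to store how many pivots are kept, because deleting a
later point does not change the earlier pivots (`take_pivots_of_kill`).

A node with `a` deletions left and `f` kept pivots is the root of a subtree with at most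
`min ((d + 3) ^ a) (2 ^ (a + (d + 1 - f)))` leaves: the first bound counts children, the second
one is the identity `sum_two_pow_add`. As each level deletes a point, the number of nodes is larger
by at most a factor `n + 1` (`potential_children`).

The tree is explored with a queue whose entries are pairs of a bit mask of the deleted points and
the number of kept pivots. All work at one node is done by a program whose only loops are
`for v < n` (`Block`). Such a program computes a total function of the memory, and it is polynomial
for syntactic reasons (`Block.exec_compile`). What remains is the correctness of these functions
(`processNode_spec`) and one unbounded loop, which is controlled by the potential of the queue
(`exec_loop`).
-/

namespace EEO

/-! ### Greedy elimination on the Gram matrix -/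

/-- The state of the elimination: the pivots chosen so far, in order, and the residual matrix.
The first pivot is the origin of the coordinates, so `k + 1` pivots account for dimension `k`. -/
structure Elim where
  pivots : List ℕ
  res : ℕ → ℕ → ℝ

/-- The elimination processes the point `p`: a deleted point is skipped, the first alive point
becomes the origin, and a later one becomes a pivot if its residual is positive and the pivots do
not yet span dimension `d`. -/
noncomputable def Elim.step (ρ : ℕ → ℕ → ℝ) (d : ℕ) (dead : ℕ → Bool) (E : Elim) (p : ℕ) : Elim :=
  if dead p = true then E
  else if E.pivots = [] then ⟨[p], fun x y => (ρ p x * ρ p x + ρ p y * ρ p y - ρ x y * ρ x y) / 2⟩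
  else if 0 < E.res p p ∧ E.pivots.length ≤ d then
    ⟨E.pivots ++ [p], fun x y => E.res x y - E.res p x * E.res p y / E.res p p⟩
  else E

/-- The elimination after the points `0, …, q - 1`, for distances `ρ`, dimension `d` and deleted
points `dead`. -/
noncomputable def elim (ρ : ℕ → ℕ → ℝ) (d : ℕ) (dead : ℕ → Bool) : ℕ → Elim
  | 0 => ⟨[], fun _ _ => 0⟩
  | q + 1 => (elim ρ d dead q).step ρ d dead q

section Elimination

variable {ρ : ℕ → ℕ → ℝ} {d : ℕ} {dead : ℕ → Bool}

theorem elim_step_cases (E : Elim) (p : ℕ) :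
    (E.step ρ d dead p = E ∧
      (dead p = true ∨ (E.pivots ≠ [] ∧ (E.res p p ≤ 0 ∨ d < E.pivots.length)))) ∨
    (dead p = false ∧ E.pivots = [] ∧ E.step ρ d dead p =
      ⟨[p], fun x y => (ρ p x * ρ p x + ρ p y * ρ p y - ρ x y * ρ x y) / 2⟩) ∨
    (dead p = false ∧ E.pivots ≠ [] ∧ 0 < E.res p p ∧ E.pivots.length ≤ d ∧
      E.step ρ d dead p =
        ⟨E.pivots ++ [p], fun x y => E.res x y - E.res p x * E.res p y / E.res p p⟩) := by
  unfold Elim.step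
  by_cases h1 : dead p = true
  · simp [h1]
  by_cases h2 : E.pivots = []
  · simp [h1, h2]
  by_cases h3 : 0 < E.res p p ∧ E.pivots.length ≤ d
  · right; right
    simp [h1, h2, h3]
  · left
    refine ⟨by rw [if_neg h1, if_neg h2, if_neg h3], Or.inr ⟨h2, ?_⟩⟩
    by_contra! hc
    exact h3 hc

theorem elim_pivots_prefix_succ (q : ℕ) :
    (elim ρ d dead q).pivots <+: (elim ρ d dead (q + 1)).pivots := by
  rw [elim]
  rcases elim_step_cases (ρ := ρ) (d := d) (dead := dead) (elim ρ d dead q) q with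
    ⟨h, -⟩ | ⟨-, h0, h⟩ | ⟨-, -, -, -, h⟩
  · rw [h]
  · rw [h0]; exact List.nil_prefix
  · rw [h]; exact List.prefix_append _ _

theorem elim_pivots_prefix {q r : ℕ} (h : q ≤ r) :
    (elim ρ d dead q).pivots <+: (elim ρ d dead r).pivots := by
  induction h with
  | refl => exact List.prefix_rfl
  | step _ ih => exact ih.trans (elim_pivots_prefix_succ _)

theorem lt_and_alive_of_mem_pivots {q p : ℕ} (hp : p ∈ (elim ρ d dead q).pivots) :
    p < q ∧ dead p = false := by
  induction q with
  | zero => simp [elim] at hp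
  | succ q ih =>
    rw [elim] at hp
    rcases elim_step_cases (ρ := ρ) (d := d) (dead := dead) (elim ρ d dead q) q with
      ⟨h, -⟩ | ⟨ha, -, h⟩ | ⟨ha, -, -, -, h⟩ <;> rw [h] at hp
    · exact ⟨(ih hp).1.trans q.lt_succ_self, (ih hp).2⟩
    · rw [List.mem_singleton] at hp
      exact ⟨by omega, hp ▸ ha⟩
    · rw [List.mem_append, List.mem_singleton] at hp
      rcases hp with hp | rfl
      · exact ⟨(ih hp).1.trans q.lt_succ_self, (ih hp).2⟩
      · exact ⟨Nat.lt_succ_self _, ha⟩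

theorem length_pivots_le (q : ℕ) :
    (elim ρ d dead q).pivots.length ≤ q ∧ (elim ρ d dead q).pivots.length ≤ d + 1 := by
  induction q with
  | zero => simp [elim]
  | succ q ih =>
    rw [elim]
    rcases elim_step_cases (ρ := ρ) (d := d) (dead := dead) (elim ρ d dead q) q with
      ⟨h, -⟩ | ⟨-, -, h⟩ | ⟨-, -, -, hl, h⟩ <;> rw [h]
    · omega
    · simp
    · simp only [List.length_append, List.length_singleton]; omega

theorem dead_of_pivots_eq_nil {q p : ℕ} (h : (elim ρ d dead q).pivots = []) (hp : p < q) :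
    dead p = true := by
  induction q with
  | zero => omega
  | succ q ih =>
    rw [elim] at h
    rcases elim_step_cases (ρ := ρ) (d := d) (dead := dead) (elim ρ d dead q) q with
      ⟨h', h2⟩ | ⟨-, -, h'⟩ | ⟨-, -, -, -, h'⟩ <;> rw [h'] at h
    · rcases Nat.lt_succ_iff_lt_or_eq.1 hp with hp | rfl
      · exact ih h hp
      · rcases h2 with h2 | h2
        · exact h2
        · exact absurd h h2.1
    · simp at h
    · simp at h

/-- The Gram matrix is the residual matrix plus a Gram matrix of vectors, one coordinate for each
pivot other than the origin. -/
theorem exists_partial_factorization (q : ℕ) (hq : (elim ρ d dead q).pivots ≠ []) :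
    ∃ (b : ℕ) (φ : ℕ → EuclideanSpace ℝ (Fin d)),
      (∀ x (i : Fin d), (elim ρ d dead q).pivots.length ≤ i + 1 → φ x i = 0) ∧
      ∀ x y, (ρ b x * ρ b x + ρ b y * ρ b y - ρ x y * ρ x y) / 2 =
        (elim ρ d dead q).res x y + inner ℝ (φ x) (φ y) := by
  induction q with
  | zero => simp [elim] at hq
  | succ q ih =>
    rw [elim] at hq ⊢
    rcases elim_step_cases (ρ := ρ) (d := d) (dead := dead) (elim ρ d dead q) q with
      ⟨h, -⟩ | ⟨-, -, h⟩ | ⟨-, hne, hpos, hl, h⟩ <;> rw [h] at hq ⊢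
    · exact ih hq
    · exact ⟨q, fun _ => 0, by simp, by simp⟩
    · obtain ⟨b, φ, h0, hφ⟩ := ih hne
      have hlen := List.length_pos_iff.2 hne
      set E := elim ρ d dead q
      let i : Fin d := ⟨E.pivots.length - 1, by omega⟩
      have hi : ∀ x, φ x i = 0 := fun x => h0 x i (by simp only [i]; omega)
      -- the pivot row, scaled as in the Cholesky decomposition, fills the next free coordinate
      refine ⟨b, fun x => φ x + EuclideanSpace.single i (E.res q x / √(E.res q q)), ?_, ?_⟩
      · intro x j hj
        simp only [List.length_append, List.length_singleton] at hj
        have hji : j ≠ i := by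
          rintro rfl
          simp only [i] at hj
          omega
        simp [h0 x j (by omega), hji]
      · intro x y
        have hs : √(E.res q q) * √(E.res q q) = E.res q q := Real.mul_self_sqrt hpos.le
        simp only [hφ x y, inner_add_left, inner_add_right, EuclideanSpace.inner_single_left,
          EuclideanSpace.inner_single_right, hi, PiLp.single_apply]
        simp only [conj_trivial, if_true, mul_zero, zero_add, add_zero]
        rw [div_mul_div_comm, hs]
        ring

theorem embedding_of_res_eq_zero (hρ : ∀ x y, 0 ≤ ρ x y) (hself : ∀ x, ρ x x = 0) (q : ℕ)
    (hz : ∀ x y, x < q → y < q → dead x = false → dead y = false →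
      (elim ρ d dead q).res x y = 0) :
    ∃ φ : ℕ → EuclideanSpace ℝ (Fin d), ∀ x y, x < q → y < q → dead x = false → dead y = false →
      ρ x y = ‖φ x - φ y‖ := by
  by_cases hq : (elim ρ d dead q).pivots = []
  · refine ⟨fun _ => 0, fun x y hx _ hx' => ?_⟩
    simp [dead_of_pivots_eq_nil hq hx] at hx'
  obtain ⟨b, φ, -, hφ⟩ := exists_partial_factorization q hq
  refine ⟨φ, fun x y hx hy hx' hy' => ?_⟩
  have h1 := hφ x x
  have h2 := hφ y y
  have h3 := hφ x y
  rw [hz _ _ hx hx hx' hx', hself] at h1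
  rw [hz _ _ hy hy hy' hy', hself] at h2
  rw [hz _ _ hx hy hx' hy'] at h3
  rw [real_inner_self_eq_norm_sq] at h1 h2
  have h4 := norm_sub_sq_real (φ x) (φ y)
  refine (sq_eq_sq₀ (hρ x y) (norm_nonneg _)).1 ?_
  rw [h4]
  linarith

/-- If the pivots lie in a set `S` that embeds into `ℝ^d`, then the residual matrix on `S` is the
Gram matrix of vectors orthogonal to a space `K` spanned by all pivots (seen from the origin). As
long as the pivots do not span `ℝ^d`, the vectors of all processed alive points of `S` are zero.
-/
theorem exists_residual_vectors {S : Set ℕ} {φ : ℕ → EuclideanSpace ℝ (Fin d)}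
    (hφ : ∀ u ∈ S, ∀ v ∈ S, ρ u v = ‖φ u - φ v‖) (q : ℕ)
    (hq : (elim ρ d dead q).pivots ≠ []) (hS : ∀ p ∈ (elim ρ d dead q).pivots, p ∈ S) :
    ∃ (w : ℕ → EuclideanSpace ℝ (Fin d)) (K : Submodule ℝ (EuclideanSpace ℝ (Fin d))),
      Module.finrank ℝ K + 1 = (elim ρ d dead q).pivots.length ∧
      (∀ u ∈ S, w u ∈ Kᗮ) ∧
      (∀ u ∈ S, ∀ v ∈ S, (elim ρ d dead q).res u v = inner ℝ (w u) (w v)) ∧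
      (∀ u ∈ S, u < q → dead u = false → (elim ρ d dead q).pivots.length ≤ d → w u = 0) := by
  induction q with
  | zero => simp [elim] at hq
  | succ q ih =>
    have hpre := elim_pivots_prefix_succ (ρ := ρ) (d := d) (dead := dead) q
    have hSq : ∀ p ∈ (elim ρ d dead q).pivots, p ∈ S := fun p hp => hS p (hpre.subset hp)
    rw [elim] at hq hS ⊢
    rcases elim_step_cases (ρ := ρ) (d := d) (dead := dead) (elim ρ d dead q) q with
      ⟨h, hc⟩ | ⟨-, hnil, h⟩ | ⟨-, hne, hpos, hl, h⟩ <;> rw [h] at hq hS ⊢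
    · obtain ⟨w, K, h1, h2, h3, h4⟩ := ih hq hSq
      refine ⟨w, K, h1, h2, h3, fun u hu huq hd hle => ?_⟩
      rcases Nat.lt_succ_iff_lt_or_eq.1 huq with huq | rfl
      · exact h4 u hu huq hd hle
      · rcases hc with hc | ⟨-, hc | hc⟩
        · simp [hc] at hd
        · rw [h3 u hu u hu] at hc
          rw [real_inner_self_eq_norm_sq] at hc
          exact norm_eq_zero.1 (pow_eq_zero_iff two_ne_zero |>.1 (le_antisymm hc (sq_nonneg _)))
        · omega
    · have hqS : q ∈ S := hS q (by simp)
      refine ⟨fun u => φ u - φ q, ⊥, by simp, by simp, fun u hu v hv => ?_, fun u hu huq hd _ => ?_⟩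
      · have e : φ u - φ v = (φ u - φ q) - (φ v - φ q) := by abel
        have h4 := norm_sub_sq_real (φ u - φ q) (φ v - φ q)
        rw [← e] at h4
        simp only [hφ q hqS u hu, hφ q hqS v hv, hφ u hu v hv, norm_sub_rev (φ q)]
        linarith
      · rcases Nat.lt_succ_iff_lt_or_eq.1 huq with huq | rfl
        · simp [dead_of_pivots_eq_nil hnil huq] at hd
        · simp
    · obtain ⟨w, K, h1, h2, h3, h4⟩ := ih hne hSq
      have hqS : q ∈ S := hS q (by simp)
      set E := elim ρ d dead q
      have hqq : E.res q q = inner ℝ (w q) (w q) := h3 q hqS q hqS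
      have hw : w q ≠ 0 := by
        intro h0
        rw [hqq, h0, inner_zero_left] at hpos
        exact lt_irrefl _ hpos
      have hqq0 : (inner ℝ (w q) (w q) : ℝ) ≠ 0 := by rw [← hqq]; exact hpos.ne'
      have hinK : ∀ k ∈ K, ∀ u ∈ S, inner ℝ k (w u) = 0 := fun k hk u hu =>
        (Submodule.mem_orthogonal K _).1 (h2 u hu) k hk
      have hwK : w q ∉ K := fun hm => hqq0 (hinK _ hm q hqS)
      -- eliminating with the pivot `q` projects all residual vectors to the complement of `w q`
      refine ⟨fun u => w u - (inner ℝ (w q) (w u) / inner ℝ (w q) (w q)) • w q,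
        K ⊔ Submodule.span ℝ {w q}, ?_, ?_, ?_, ?_⟩
      · rw [Submodule.finrank_sup_span_singleton hwK, h1]
        simp
      · intro u hu
        rw [Submodule.mem_orthogonal]
        intro k hk
        obtain ⟨k, hkK, z, hz, rfl⟩ := Submodule.mem_sup.1 hk
        obtain ⟨a, rfl⟩ := Submodule.mem_span_singleton.1 hz
        simp only [inner_add_left, inner_sub_right, inner_smul_right, inner_smul_left,
          hinK k hkK u hu, hinK k hkK q hqS, conj_trivial]
        field_simp
        ring
      · intro u hu v hv
        simp only [h3 u hu v hv, h3 q hqS u hu, h3 q hqS v hv, hqq, inner_sub_left,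
          inner_sub_right, inner_smul_right, inner_smul_left, conj_trivial,
          real_inner_comm (w q) (w u)]
        field_simp
        ring
      · intro u hu huq hd hle
        rcases Nat.lt_succ_iff_lt_or_eq.1 huq with huq | rfl
        · have := h4 u hu huq hd hl
          simp [this]
        · simp only [div_self hqq0, one_smul, sub_self]

/-- A nonzero residual at `x, y` is an obstruction: the pivots and `x, y` do not embed. -/
theorem res_eq_zero_of_embedding {S : Set ℕ} {φ : ℕ → EuclideanSpace ℝ (Fin d)}
    (hφ : ∀ u ∈ S, ∀ v ∈ S, ρ u v = ‖φ u - φ v‖) {q x y : ℕ}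
    (hS : ∀ p ∈ (elim ρ d dead q).pivots, p ∈ S) (hx : x ∈ S) (hy : y ∈ S) (hxq : x < q)
    (hxd : dead x = false) : (elim ρ d dead q).res x y = 0 := by
  have hq : (elim ρ d dead q).pivots ≠ [] := by
    intro h
    simp [dead_of_pivots_eq_nil h hxq] at hxd
  obtain ⟨w, K, h1, h2, h3, h4⟩ := exists_residual_vectors hφ q hq hS
  suffices w x = 0 by rw [h3 x hx y hy, this, inner_zero_left]
  by_cases hl : (elim ρ d dead q).pivots.length ≤ d
  · exact h4 x hx hxq hxd hl
  -- with `d + 1` pivots there is no room for a nonzero residual vector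
  · have hK : K = ⊤ := by
      apply Submodule.eq_top_of_finrank_eq
      rw [finrank_euclideanSpace_fin]
      have := (length_pivots_le (ρ := ρ) (d := d) (dead := dead) q).2
      omega
    have := h2 x hx
    rwa [hK, Submodule.top_orthogonal_eq_bot, Submodule.mem_bot] at this

/-- Deleting one more point `p` does not change the first `j` pivots if `p` is not one of them.
-/
theorem take_pivots_of_kill {dead' : ℕ → Bool} {p : ℕ}
    (hdead : ∀ r, dead' r = (dead r || decide (r = p))) (N j : ℕ)
    (hp : p ∉ (elim ρ d dead N).pivots.take j) :
    (elim ρ d dead' N).pivots.take j = (elim ρ d dead N).pivots.take j := by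
  -- both runs coincide until they reach `p`, unless the first `j` pivots are chosen before `p`
  suffices H : ∀ r ≤ N, elim ρ d dead' r = elim ρ d dead r ∨
      (j ≤ (elim ρ d dead r).pivots.length ∧ j ≤ (elim ρ d dead' r).pivots.length ∧
        (elim ρ d dead' r).pivots.take j = (elim ρ d dead r).pivots.take j) by
    rcases H N le_rfl with h | h
    · rw [h]
    · exact h.2.2
  intro r hr
  induction r with
  | zero => left; simp [elim]
  | succ r ih =>
    rcases ih (by omega) with h | ⟨h1, h2, h3⟩
    · by_cases hrp : r = p
      · subst hrp
        have e' : elim ρ d dead' (r + 1) = elim ρ d dead r := by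
          rw [elim, h, Elim.step, if_pos (by simp [hdead])]
        have hpre := elim_pivots_prefix (ρ := ρ) (d := d) (dead := dead) hr
        rw [elim] at hpre
        rw [e', elim]
        by_cases hj : j ≤ (elim ρ d dead r).pivots.length
        · right
          have hpre' := elim_pivots_prefix_succ (ρ := ρ) (d := d) (dead := dead) r
          rw [elim] at hpre'
          refine ⟨hj.trans hpre'.length_le, hj, ?_⟩
          obtain ⟨l, hl⟩ := hpre'
          rw [← hl, List.take_append_of_le_length hj]
        · left
          rcases elim_step_cases (ρ := ρ) (d := d) (dead := dead) (elim ρ d dead r) r with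
            ⟨h, -⟩ | ⟨-, hn, h⟩ | ⟨-, -, -, -, h⟩
          · exact h.symm
          · exfalso
            rw [h] at hpre
            obtain ⟨l, hl⟩ := hpre
            rw [hn, List.length_nil] at hj
            apply hp
            obtain ⟨j, rfl⟩ : ∃ i, j = i + 1 := ⟨j - 1, by omega⟩
            rw [← hl]
            simp
          · exfalso
            rw [h] at hpre
            obtain ⟨l, hl⟩ := hpre
            apply hp
            obtain ⟨i, rfl⟩ : ∃ i, j = (elim ρ d dead r).pivots.length + (i + 1) :=
              ⟨j - (elim ρ d dead r).pivots.length - 1, by omega⟩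
            rw [← hl, List.append_assoc, List.take_length_add_append]
            simp
      · left
        rw [elim, elim, h, Elim.step, Elim.step, hdead]
        simp [hrp]
    · right
      obtain ⟨l, hl⟩ := elim_pivots_prefix_succ (ρ := ρ) (d := d) (dead := dead) r
      obtain ⟨l', hl'⟩ := elim_pivots_prefix_succ (ρ := ρ) (d := d) (dead := dead') r
      rw [← hl, ← hl', List.take_append_of_le_length h1, List.take_append_of_le_length h2]
      simp only [List.length_append]
      exact ⟨by omega, by omega, h3⟩

end Elimination

/-! ### Structured programs -/

open RealRAM

/-- Names of the integer arrays of the program; a scalar is the cell `0` of its array. Arrays: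
`row x = x * n`, `pow x = 2 ^ x`, the queue `maskQ`, `forcedQ` of nodes, the indicator `del` of
the deleted points, and the pivots `bas`. Scalars: the bounds `head`, `tail` of the pending part
of the queue, the answer `found`, the undecoded part `rem` of a mask, the number `m` of pivots,
the indices `p, x, y, i`, the flag `bad` and the position `badX, badY` of a nonzero
residual, and the number `cnt` and the weight `wsum` of the deleted points. -/
inductive Var where
  | row | pow | maskQ | forcedQ | del | bas
  | head | tail | found | rem | m | p | x | y | i | bad | badX | badY | cnt | wsum
  deriving DecidableEq

/-- The residue class modulo `32` of the cells that hold the array, counted from the end of the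
input: the entry `i` of `a` is in the cell `n + 4 + a.code + 32 * i`. -/
def Var.code : Var → ℕ
  | row => 0 | pow => 1 | maskQ => 2 | forcedQ => 3 | del => 4 | bas => 5
  | head => 6 | tail => 7 | found => 8 | rem => 9 | m => 10 | p => 11 | x => 12 | y => 13
  | i => 14 | bad => 15 | badX => 16 | badY => 17 | cnt => 18 | wsum => 19

theorem Var.code_lt (a : Var) : a.code < 32 := by cases a <;> decide

theorem Var.code_injective : Function.Injective Var.code := by
  intro a b h
  cases a <;> cases b <;> first | rfl | (exact absurd h (by decide))

/-- The address of the entry `i` of the array `a`; the cell `0` holds `n` throughout. -/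
def slot (s : State) (a : Var) (i : ℕ) : ℕ := s.int 0 + (4 + a.code) + 32 * i

/-- The entry `i` of the integer array `a`. -/
def iv (s : State) (a : Var) (i : ℕ) : ℕ := s.int (slot s a i)

/-- The memory after writing `v` into the entry `i` of the integer array `a`. -/
def iset (s : State) (a : Var) (i v : ℕ) : State :=
  { s with int := Function.update s.int (slot s a i) v }

/-- The memory after writing `v` into the real cell `i`. -/
def rset (s : State) (i : ℕ) (v : ℝ) : State :=
  { s with real := Function.update s.real i v }

theorem int_iset_of_lt {s : State} {a : Var} {i v j : ℕ} (hj : j < s.int 0 + 4) :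
    (iset s a i v).int j = s.int j :=
  Function.update_of_ne (by unfold slot; omega) _ _

@[simp] theorem int_zero_iset (s : State) (a : Var) (i v : ℕ) : (iset s a i v).int 0 = s.int 0 :=
  int_iset_of_lt (by omega)

@[simp] theorem real_iset (s : State) (a : Var) (i v : ℕ) : (iset s a i v).real = s.real := rfl

@[simp] theorem real_rset (s : State) (i : ℕ) (v : ℝ) (j : ℕ) :
    (rset s i v).real j = if j = i then v else s.real j :=
  Function.update_apply _ _ _ _

@[simp] theorem iv_iset (s : State) (a : Var) (i v : ℕ) (b : Var) (j : ℕ) :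
    iv (iset s a i v) b j = if b = a ∧ j = i then v else iv s b j := by
  have e : slot (iset s a i v) b j = slot s b j := by simp [slot]
  unfold iv
  rw [e]
  unfold iset
  simp only [Function.update_apply]
  by_cases h : b = a ∧ j = i
  · obtain ⟨rfl, rfl⟩ := h
    simp
  · rw [if_neg h, if_neg]
    intro h'
    have ha := a.code_lt
    have hb := b.code_lt
    unfold slot at h'
    exact h ⟨Var.code_injective (by omega), by omega⟩

/-- The expression for the address of an array entry; the factor `32` is made of five doublings. -/
def addr (a : Var) (e : IExp) : IExp :=
  let dbl : IExp → IExp := fun e => .add e e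
  .add (.add (.load (.const 0)) (.const (4 + a.code))) (dbl (dbl (dbl (dbl (dbl e)))))

theorem eval_addr (s : State) (a : Var) (e : IExp) : (addr a e).eval s = slot s a (e.eval s) := by
  simp only [addr, IExp.eval, slot]
  omega

/-- The expression for an array entry. -/
def arr (a : Var) (e : IExp) : IExp := .load (addr a e)

@[simp] theorem eval_arr (s : State) (a : Var) (e : IExp) :
    (arr a e).eval s = iv s a (e.eval s) := by
  simp only [arr, IExp.eval, eval_addr, iv]

/-- The expression for a scalar. -/
def sca (a : Var) : IExp := arr a (.const 0)

@[simp] theorem eval_sca (s : State) (a : Var) : (sca a).eval s = iv s a 0 := by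
  simp [sca, IExp.eval]

/-- Programs whose only loops are `forN v p`, which executes `p` for `v = 0, …, n - 1`, and whose
integer writes go to arrays only, so that they never touch the integer input. -/
inductive Block where
  | skip
  | iset (a : Var) (i e : IExp)
  | rset (i : IExp) (e : RExp)
  | seq (p q : Block)
  | ite (b : Test) (p q : Block)
  | forN (v : Var) (p : Block)

infixr:60 " ;; " => Block.seq

namespace Block

def nExp : IExp := .load (.const 0)

/-- Translation into real RAM programs. -/
def compile : Block → Prog
  | skip => .skip
  | iset a i e => .istore (addr a i) e
  | rset i e => .rstore i e
  | seq p q => .seq p.compile q.compile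
  | ite b p q => .ite b p.compile q.compile
  | forN v p => .seq (.istore (addr v (.const 0)) (.const 0))
      (.loop (.not (.ile nExp (sca v)))
        (.seq p.compile (.istore (addr v (.const 0)) (.add (sca v) (.const 1)))))

open Classical in
/-- The effect of a block on the memory. In `forN v p` the counter is incremented in memory,
which agrees with the intended `n` rounds if `p` does not write to `v`. -/
noncomputable def run : Block → State → State
  | skip, s => s
  | iset a i e, s => EEO.iset s a (i.eval s) (e.eval s)
  | rset i e, s => EEO.rset s (i.eval s) (e.eval s)
  | seq p q, s => q.run (p.run s)
  | ite b p q, s => if b.Holds s then p.run s else q.run s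
  | forN v p, s => (fun s' => EEO.iset (p.run s') v 0 (iv (p.run s') v 0 + 1))^[s.int 0]
      (EEO.iset s v 0 0)

/-- Whether the block contains a write to the array `a`. -/
def writes (a : Var) : Block → Bool
  | skip => false
  | iset b _ _ => decide (a = b)
  | rset _ _ => false
  | seq p q => p.writes a || q.writes a
  | ite _ p q => p.writes a || q.writes a
  | forN v p => decide (a = v) || p.writes a

/-- Whether the block contains a write to the real memory. -/
def writesReal : Block → Bool
  | skip => false
  | iset _ _ _ => false
  | rset _ _ => true
  | seq p q => p.writesReal || q.writesReal
  | ite _ p q => p.writesReal || q.writesReal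
  | forN _ p => p.writesReal

/-- No loop body writes to its loop counter. -/
def wf : Block → Bool
  | skip => true
  | iset _ _ _ => true
  | rset _ _ => true
  | seq p q => p.wf && q.wf
  | ite _ p q => p.wf && q.wf
  | forN v p => !p.writes v && p.wf

/-- Nesting depth of the loops. -/
def depth : Block → ℕ
  | skip => 0
  | iset _ _ _ => 0
  | rset _ _ => 0
  | seq p q => max p.depth q.depth
  | ite _ p q => max p.depth q.depth
  | forN _ p => p.depth + 1

/-- A coefficient for the running time, see `exec_compile`. -/
def coeff : Block → ℕ
  | skip => 1
  | iset a i e => (addr a i).cost + e.cost + 1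
  | rset i e => i.cost + e.cost + 1
  | seq p q => p.coeff + q.coeff
  | ite b p q => b.cost + 1 + (p.coeff + q.coeff)
  | forN v p => ((addr v (.const 0)).cost + (IExp.const 0).cost + 1) +
      ((Test.not (.ile nExp (sca v))).cost + 1) + p.coeff +
      ((addr v (.const 0)).cost + (IExp.add (sca v) (.const 1)).cost + 1)

/-- `s` and `s'` agree in everything that `p` cannot change. -/
structure Frame (p : Block) (s s' : State) : Prop where
  int_of_lt : ∀ j < s.int 0 + 4, s'.int j = s.int j
  iv_eq : ∀ a, p.writes a = false → ∀ j, iv s' a j = iv s a j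
  real_eq : p.writesReal = false → s'.real = s.real

theorem Frame.int_zero {p : Block} {s s' : State} (h : Frame p s s') : s'.int 0 = s.int 0 :=
  h.int_of_lt 0 (by omega)

theorem Frame.refl (p : Block) (s : State) : Frame p s s := ⟨by simp, by simp, by simp⟩

theorem Frame.trans {p : Block} {s₁ s₂ s₃ : State} (h : Frame p s₁ s₂) (h' : Frame p s₂ s₃) :
    Frame p s₁ s₃ where
  int_of_lt j hj := (h'.int_of_lt j (by rwa [h.int_zero])).trans (h.int_of_lt j hj)
  iv_eq a ha j := (h'.iv_eq a ha j).trans (h.iv_eq a ha j)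
  real_eq hr := (h'.real_eq hr).trans (h.real_eq hr)

theorem Frame.mono {p q : Block} {s s' : State} (h : Frame p s s')
    (hw : ∀ a, q.writes a = false → p.writes a = false)
    (hr : q.writesReal = false → p.writesReal = false) : Frame q s s' :=
  ⟨h.int_of_lt, fun a ha => h.iv_eq a (hw a ha), fun h' => h.real_eq (hr h')⟩

theorem frame_iset (a : Var) (i v : ℕ) (s : State) (p : Block) (hp : p.writes a = true) :
    Frame p s (EEO.iset s a i v) where
  int_of_lt j hj := int_iset_of_lt hj
  iv_eq b hb j := by
    rw [iv_iset, if_neg]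
    rintro ⟨rfl, -⟩
    rw [hb] at hp
    exact Bool.false_ne_true hp
  real_eq _ := rfl

theorem frame_run (p : Block) (s : State) : Frame p s (p.run s) := by
  induction p generalizing s with
  | skip => exact Frame.refl _ _
  | iset a i e => exact frame_iset _ _ _ _ _ (by simp [writes])
  | rset i e => exact ⟨fun _ _ => rfl, fun _ _ _ => rfl, by simp [writesReal]⟩
  | seq p q ihp ihq =>
    have h1 : Frame (seq p q) s (p.run s) :=
      (ihp s).mono (by simp +contextual [writes]) (by simp +contextual [writesReal])
    have h2 : Frame (seq p q) (p.run s) (q.run (p.run s)) :=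
      (ihq _).mono (by simp +contextual [writes]) (by simp +contextual [writesReal])
    exact h1.trans h2
  | ite b p q ihp ihq =>
    rw [run]
    split_ifs
    · exact (ihp s).mono (by simp +contextual [writes]) (by simp +contextual [writesReal])
    · exact (ihq s).mono (by simp +contextual [writes]) (by simp +contextual [writesReal])
  | forN v p ih =>
    rw [run]
    have h0 : Frame (forN v p) s (EEO.iset s v 0 0) := frame_iset _ _ _ _ _ (by simp [writes])
    generalize s.int 0 = N
    generalize EEO.iset s v 0 0 = s' at h0
    induction N generalizing s' with
    | zero => exact h0
    | succ N ihN =>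
      rw [Function.iterate_succ_apply]
      apply ihN
      have h1 : Frame (forN v p) s' (p.run s') :=
        (ih s').mono (by simp +contextual [writes]) (by simp +contextual [writesReal])
      exact (h0.trans h1).trans (frame_iset _ _ _ _ _ (by simp [writes]))

/-- After `j` rounds of a loop the counter is `j`. -/
theorem run_forN_state {v : Var} {p : Block} (hv : p.writes v = false) (s : State) (j : ℕ) :
    ∀ s', s' = (fun s' => EEO.iset (p.run s') v 0 (iv (p.run s') v 0 + 1))^[j]
      (EEO.iset s v 0 0) → iv s' v 0 = j ∧ Frame (forN v p) s s' := by
  induction j with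
  | zero =>
    rintro s' rfl
    exact ⟨by simp, frame_iset _ _ _ _ _ (by simp [writes])⟩
  | succ j ih =>
    rintro s' rfl
    obtain ⟨h1, h2⟩ := ih _ rfl
    rw [Function.iterate_succ_apply']
    set s' := (fun s' => EEO.iset (p.run s') v 0 (iv (p.run s') v 0 + 1))^[j] (EEO.iset s v 0 0)
    refine ⟨by simp [(frame_run p s').iv_eq v hv, h1], ?_⟩
    have h3 : Frame (forN v p) s' (p.run s') :=
      (frame_run p s').mono (by simp +contextual [writes]) (by simp +contextual [writesReal])
    exact (h2.trans h3).trans (frame_iset _ _ _ _ _ (by simp [writes]))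

/-- The invariant rule for loops. The round `j` may use that the counter is `j` and that the
memory agrees with the initial one outside of what the loop writes. -/
theorem run_forN_induct {v : Var} {p : Block} {s : State} (Inv : ℕ → State → Prop)
    (hv : p.writes v = false) (h0 : Inv 0 (EEO.iset s v 0 0))
    (hstep : ∀ j s', j < s.int 0 → Frame (forN v p) s s' → iv s' v 0 = j → Inv j s' →
      Inv (j + 1) (EEO.iset (p.run s') v 0 (j + 1))) :
    Inv (s.int 0) ((forN v p).run s) := by
  rw [run]
  suffices H : ∀ j ≤ s.int 0, Inv j ((fun s' => EEO.iset (p.run s') v 0 (iv (p.run s') v 0 + 1))^[j]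
      (EEO.iset s v 0 0)) from H _ le_rfl
  intro j hj
  induction j with
  | zero => exact h0
  | succ j ih =>
    obtain ⟨h1, h2⟩ := run_forN_state hv s j _ rfl
    have h3 := hstep j _ hj h2 h1 (ih (by omega))
    rw [Function.iterate_succ_apply']
    convert h3 using 2
    rw [(frame_run p _).iv_eq v hv, h1]

/-- A block halts after at most `coeff * (n + 1) ^ depth` steps, with the memory given by `run`.
-/
theorem exec_compile (p : Block) (hp : p.wf = true) (s : State) :
    ∃ t, Exec p.compile s t (p.run s) ∧ t ≤ p.coeff * (s.int 0 + 1) ^ p.depth := by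
  induction p generalizing s with
  | skip => exact ⟨1, .skip s, by simp [coeff, depth]⟩
  | iset a i e =>
    refine ⟨_, Exec.istore (addr a i) e s |> fun h => ?_, by simp [coeff, depth]; rfl⟩
    simpa only [run, compile, EEO.iset, eval_addr] using h
  | rset i e => exact ⟨_, Exec.rstore i e s, by simp [coeff, depth]⟩
  | seq p q ihp ihq =>
    simp only [wf, Bool.and_eq_true] at hp
    obtain ⟨t, h, ht⟩ := ihp hp.1 s
    obtain ⟨t', h', ht'⟩ := ihq hp.2 (p.run s)
    refine ⟨_, .seq h h', ?_⟩
    rw [(frame_run p s).int_zero] at ht'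
    simp only [coeff, depth, add_mul]
    have hn : 0 < s.int 0 + 1 := by omega
    gcongr
    · exact ht.trans (Nat.mul_le_mul_left _ (Nat.pow_le_pow_right hn (le_max_left _ _)))
    · exact ht'.trans (Nat.mul_le_mul_left _ (Nat.pow_le_pow_right hn (le_max_right _ _)))
  | ite b p q ihp ihq =>
    simp only [wf, Bool.and_eq_true] at hp
    have hn : 0 < s.int 0 + 1 := by omega
    have hpos : 1 ≤ (s.int 0 + 1) ^ max p.depth q.depth := Nat.one_le_pow _ _ hn
    have hb : b.cost + 1 ≤ (b.cost + 1) * (s.int 0 + 1) ^ max p.depth q.depth :=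
      Nat.le_mul_of_pos_right _ hpos
    rw [run]
    simp only [coeff, depth, add_mul _ (_ + _), add_mul p.coeff]
    split_ifs with hbs
    · obtain ⟨t, h, ht⟩ := ihp hp.1 s
      refine ⟨_, .ite_true hbs h, ?_⟩
      have := ht.trans (Nat.mul_le_mul_left _ (Nat.pow_le_pow_right hn (le_max_left _ q.depth)))
      omega
    · obtain ⟨t, h, ht⟩ := ihq hp.2 s
      refine ⟨_, .ite_false hbs h, ?_⟩
      have := ht.trans (Nat.mul_le_mul_left _ (Nat.pow_le_pow_right hn (le_max_right p.depth _)))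
      omega
  | forN v p ih =>
    simp only [wf, Bool.and_eq_true, Bool.not_eq_true'] at hp
    obtain ⟨hv, hp⟩ := hp
    set N := s.int 0 with hN
    set test : Test := .not (.ile nExp (sca v)) with htest
    set incr : Prog := .istore (addr v (.const 0)) (.add (sca v) (.const 1)) with hincr
    obtain ⟨ci, hci⟩ : ∃ ci, ci =
      (addr v (.const 0)).cost + (IExp.add (sca v) (.const 1)).cost + 1 :=
      ⟨_, rfl⟩
    set f := fun s' => EEO.iset (p.run s') v 0 (iv (p.run s') v 0 + 1) with hf
    -- the loop started in the state after `j` rounds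
    have key : ∀ r j, j + r = N → ∃ t, Exec (.loop test (.seq p.compile incr))
        (f^[j] (EEO.iset s v 0 0)) t (f^[N] (EEO.iset s v 0 0)) ∧
        t ≤ r * (test.cost + 1 + p.coeff * (N + 1) ^ p.depth + ci) + (test.cost + 1) := by
      intro r
      induction r with
      | zero =>
        intro j hj
        rw [show j = N by omega]
        obtain ⟨h1, h2⟩ := run_forN_state hv s N _ rfl
        refine ⟨_, .loop_done ?_, by simp⟩
        rw [← hf] at h1 h2
        simp only [htest, Test.Holds, nExp, IExp.eval, eval_sca, h1, h2.int_zero, ← hN]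
        simp
      | succ r ihr =>
        intro j hj
        obtain ⟨h1, h2⟩ := run_forN_state hv s j _ rfl
        rw [← hf] at h1 h2
        set s' := f^[j] (EEO.iset s v 0 0) with hs'
        obtain ⟨t, h, ht⟩ := ihr (j + 1) (by omega)
        obtain ⟨t', h', ht'⟩ := ih hp s'
        rw [h2.int_zero, ← hN] at ht'
        have e : f^[j + 1] (EEO.iset s v 0 0) = f s' := by
          rw [Function.iterate_succ_apply']
        have hi : Exec incr (p.run s') ci (f s') := by
          have := Exec.istore (addr v (.const 0)) (.add (sca v) (.const 1)) (p.run s')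
          simpa only [hf, EEO.iset, eval_addr, IExp.eval, eval_sca, ← hci] using this
        rw [e] at h
        refine ⟨_, .loop_step ?_ (.seq h' hi) h, ?_⟩
        · simp only [htest, Test.Holds, nExp, IExp.eval, eval_sca, h1, h2.int_zero]
          omega
        · rw [Nat.add_mul]
          omega
    obtain ⟨t, h, ht⟩ := key N 0 (by omega)
    have hinit : Exec (.istore (addr v (.const 0)) (.const 0)) s
        ((addr v (.const 0)).cost + (IExp.const 0).cost + 1) (EEO.iset s v 0 0) := by
      have := Exec.istore (addr v (.const 0)) (.const 0) s
      simpa only [EEO.iset, eval_addr, IExp.eval] using this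
    refine ⟨_, .seq hinit h, ?_⟩
    simp only [coeff, depth, pow_succ]
    rw [← hci, ← htest]
    have hpos : 1 ≤ (N + 1) ^ p.depth := Nat.one_le_pow _ _ (by omega)
    generalize (N + 1) ^ p.depth = X at *
    generalize (addr v (.const 0)).cost + (IExp.const 0).cost + 1 = c0 at *
    generalize p.coeff = c1 at ht ⊢
    generalize test.cost + 1 = c2 at *
    obtain ⟨X, rfl⟩ : ∃ x, X = x + 1 := ⟨X - 1, by omega⟩
    nlinarith [Nat.zero_le (N * X * c0), Nat.zero_le (N * X * c2), Nat.zero_le (N * X * ci),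
      Nat.zero_le (N * c0), Nat.zero_le (X * c0), Nat.zero_le (X * c2), Nat.zero_le (X * ci),
      Nat.zero_le (X * c1)]

end Block

open Block

/-! ### The program -/

def kExp : IExp := .load (.const 1)
def dExp : IExp := .load (.const 2)
def wExp : IExp := .load (.const 3)

@[simp] theorem eval_nExp (s : State) : nExp.eval s = s.int 0 := rfl
@[simp] theorem eval_kExp (s : State) : kExp.eval s = s.int 1 := rfl
@[simp] theorem eval_dExp (s : State) : dExp.eval s = s.int 2 := rfl
@[simp] theorem eval_wExp (s : State) : wExp.eval s = s.int 3 := rfl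

/-- The input distance of `x` and `y`. -/
def distExp (x y : IExp) : RExp := .load (.add (arr .row x) y)

/-- The residual matrix is stored in the real cells `n² + x * n + y`. -/
def resAddr (x y : IExp) : IExp := .add (arr .row nExp) (.add (arr .row x) y)

def resExp (x y : IExp) : RExp := .load (resAddr x y)

/-- The pivot row is copied to the real cells `2n² + x`. -/
def colAddr (x : IExp) : IExp := .add (.add (arr .row nExp) (arr .row nExp)) x

def colExp (x : IExp) : RExp := .load (colAddr x)

/-- Overwrite the residual matrix with the values of `e`, row by row. -/
def fill (e : RExp) : Block :=
  .forN .x (.forN .y (.rset (resAddr (sca .x) (sca .y)) e))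

/-- The test for a natural number to be zero. -/
def isZero (e : IExp) : Test := .ile e (.const 0)

/-- Computes the arrays `row` and `pow`, and puts the root `(0, 0)` into the queue. The entries
`row 0`, `maskQ 0` and `forcedQ 0` are zero initially. -/
def initTables : Block :=
  .iset .pow (.const 0) (.const 1) ;;
  .forN .x
    (.iset .row (.add (sca .x) (.const 1)) (.add (arr .row (sca .x)) nExp) ;;
     .iset .pow (.add (sca .x) (.const 1)) (.add (arr .pow (sca .x)) (arr .pow (sca .x)))) ;;
  .iset .tail (.const 0) (.const 1)

/-- Reads the bits of the mask at the head of the queue from the top: the bit `p` of a number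
below `2 ^ (p + 1)` is set if the number is at least `2 ^ p`. -/
def decode : Block :=
  .iset .rem (.const 0) (arr .maskQ (sca .head)) ;;
  .iset .cnt (.const 0) (.const 0) ;;
  .iset .wsum (.const 0) (.const 0) ;;
  .forN .i
    (.iset .p (.const 0) (.sub (.sub nExp (.const 1)) (sca .i)) ;;
     .ite (.ile (arr .pow (sca .p)) (sca .rem))
      (.iset .rem (.const 0) (.sub (sca .rem) (arr .pow (sca .p))) ;;
       .iset .del (sca .p) (.const 1) ;;
       .iset .cnt (.const 0) (.add (sca .cnt) (.const 1)) ;;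
       .iset .wsum (.const 0) (.add (sca .wsum) (.load (.add (.const 4) (sca .p)))))
      (.iset .del (sca .p) (.const 0)))

/-- The entry of the Gram matrix with respect to the origin `p`. -/
def gramExp : RExp :=
  let sq : RExp → RExp := fun e => .mul e e
  .div (.sub (.add (sq (distExp (sca .p) (sca .x))) (sq (distExp (sca .p) (sca .y))))
    (sq (distExp (sca .x) (sca .y)))) (.const 2)

/-- The entry of the residual matrix after elimination with the pivot `p`. The old pivot row is
read from its copy, since the row itself is overwritten on the way. -/
def schurExp : RExp :=
  .sub (resExp (sca .x) (sca .y))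
    (.div (.mul (colExp (sca .x)) (colExp (sca .y))) (colExp (sca .p)))

/-- Saves the row of the pivot `p` of the residual matrix. -/
def copyColumn : Block := .forN .x (.rset (colAddr (sca .x)) (resExp (sca .p) (sca .x)))

/-- Appends `p` to the pivots. -/
def addPivot : Block :=
  .iset .bas (sca .m) (sca .p) ;; .iset .m (.const 0) (.add (sca .m) (.const 1))

/-- Computes the elimination `elim` for the decoded set of deleted points. -/
def eliminate : Block :=
  .iset .m (.const 0) (.const 0) ;;
  .forN .p (.ite (isZero (arr .del (sca .p)))
    (.ite (isZero (sca .m))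
      (fill gramExp ;; addPivot)
      (.ite (.and (.not (.rle (resExp (sca .p) (sca .p)) (.const 0))) (.ile (sca .m) dExp))
        (copyColumn ;; fill schurExp ;; addPivot)
        .skip))
    .skip)

/-- Records the position `x, y` if both points are alive and their residual is not zero. -/
def testCell : Block :=
  .ite (.and (.and (isZero (arr .del (sca .x))) (isZero (arr .del (sca .y))))
      (.not (.and (.rle (resExp (sca .x) (sca .y)) (.const 0))
        (.rle (.const 0) (resExp (sca .x) (sca .y))))))
    (.iset .bad (.const 0) (.const 1) ;;
     .iset .badX (.const 0) (sca .x) ;;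
     .iset .badY (.const 0) (sca .y))
    .skip

/-- Looks for a nonzero residual between alive points. -/
def search : Block :=
  .iset .bad (.const 0) (.const 0) ;; .forN .x (.forN .y testCell)

/-- Appends the pair `(a, b)` to the queue. -/
def push (a b : IExp) : Block :=
  .iset .maskQ (sca .tail) a ;;
  .iset .forcedQ (sca .tail) b ;;
  .iset .tail (.const 0) (.add (sca .tail) (.const 1))

/-- The mask at the head of the queue with the bit `q` added. -/
def kill (q : IExp) : IExp := .add (arr .maskQ (sca .head)) (arr .pow q)

/-- Appends the children of the node at the head of the queue. The number `m + (f - m)`, with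
truncated subtraction, is the maximum of `f` and `m`. -/
def pushChildren : Block :=
  .forN .i
    (.ite (.and (.ile (arr .forcedQ (sca .head)) (sca .i))
        (.ile (.add (sca .i) (.const 1)) (sca .m)))
      (push (kill (arr .bas (sca .i))) (sca .i))
      .skip) ;;
  push (kill (sca .badX)) (.add (sca .m) (.sub (arr .forcedQ (sca .head)) (sca .m))) ;;
  push (kill (sca .badY)) (.add (sca .m) (.sub (arr .forcedQ (sca .head)) (sca .m)))

/-- If the alive points embed, test the budgets; otherwise branch, if a deletion is left. -/
def branch : Block :=
  .ite (isZero (sca .bad))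
    (.ite (.and (.ile (sca .cnt) kExp) (.ile (sca .wsum) wExp))
      (.iset .found (.const 0) (.const 1))
      .skip)
    (.ite (.ile (.add (sca .cnt) (.const 1)) kExp) pushChildren .skip)

/-- One round of the main loop. -/
def processNode : Block :=
  decode ;; eliminate ;; search ;; branch ;; .iset .head (.const 0) (.add (sca .head) (.const 1))

/-- The condition of the main loop: there are pending nodes, and no solution has been found. -/
def pending : Test :=
  .and (.not (.ile (sca .tail) (sca .head))) (isZero (sca .found))

/-- Explore the search tree from the root, and copy the answer to the cell `0`, which held `n` until
then. -/
def program : Prog :=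
  .seq initTables.compile
    (.seq (.loop pending processNode.compile) (.istore (.const 0) (sca .found)))

/-! ### Tables, decoding and filling of matrices -/

/-- The arrays `row` and `pow` are set up. -/
structure Tables (s : State) : Prop where
  row : ∀ x ≤ s.int 0, iv s .row x = x * s.int 0
  pow : ∀ x ≤ s.int 0, iv s .pow x = 2 ^ x

theorem Tables.frame {p : Block} {s s' : State} (h : Tables s) (hf : Frame p s s')
    (hr : p.writes .row = false) (hp : p.writes .pow = false) : Tables s' where
  row x hx := by rw [hf.iv_eq _ hr, hf.int_zero]; exact h.row x (hf.int_zero ▸ hx)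
  pow x hx := by rw [hf.iv_eq _ hp]; exact h.pow x (hf.int_zero ▸ hx)

theorem initTables_spec {s : State} (h0 : ∀ a i, iv s a i = 0) :
    Tables (initTables.run s) ∧ iv (initTables.run s) .tail 0 = 1 ∧
      ∀ a, initTables.writes a = false → ∀ i, iv (initTables.run s) a i = 0 := by
  refine ⟨?_, by simp [initTables, run, IExp.eval],
    fun a ha i => by rw [(frame_run _ s).iv_eq a ha, h0]⟩
  set s₁ := EEO.iset s .pow 0 1 with hs₁
  set B := Block.forN .x
    (.iset .row (.add (sca .x) (.const 1)) (.add (arr .row (sca .x)) nExp) ;;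
     .iset .pow (.add (sca .x) (.const 1)) (.add (arr .pow (sca .x)) (arr .pow (sca .x)))) with hB
  have H : ∀ x ≤ s.int 0, iv (B.run s₁) .row x = x * s.int 0 ∧ iv (B.run s₁) .pow x = 2 ^ x := by
    have e : s.int 0 = s₁.int 0 := by simp [hs₁]
    rw [e]
    refine run_forN_induct (fun j s' => ∀ x ≤ j, iv s' .row x = x * s₁.int 0 ∧ iv s' .pow x = 2 ^ x)
      rfl ?_ ?_
    · intro x hx
      obtain rfl : x = 0 := by omega
      simp [hs₁, h0]
    · intro j s' hj hf hv hI x hx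
      have hn := hf.int_zero
      simp only [run, IExp.eval, eval_sca, eval_arr, iv_iset, hv, eval_nExp, hn]
      simp only [reduceCtorEq, false_and, true_and, if_false]
      rcases Nat.lt_succ_iff_lt_or_eq.1 (Nat.lt_succ_of_le hx) with hx | rfl
      · simp [show x ≠ j + 1 by omega, hI x (by omega)]
      · have := hI j le_rfl
        simp only [this, if_true, pow_succ]
        constructor <;> ring
  have e : initTables.run s = EEO.iset (B.run s₁) .tail 0 1 := by
    simp [initTables, run, IExp.eval, hB, hs₁]
  have e0 : (B.run s₁).int 0 = s.int 0 := by rw [(frame_run B s₁).int_zero, hs₁, int_zero_iset]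
  rw [e]
  constructor <;> intro x hx
  · simpa [e0] using (H x (by simpa [e0] using hx)).1
  · simpa using (H x (by simpa [e0] using hx)).2

theorem testBit_iff_two_pow_le_mod (a q : ℕ) : a.testBit q = true ↔ 2 ^ q ≤ a % 2 ^ (q + 1) := by
  rw [Nat.testBit_eq_decide_div_mod_eq, decide_eq_true_iff, Nat.mod_pow_succ]
  have h1 : a % 2 ^ q < 2 ^ q := Nat.mod_lt _ (by positivity)
  rcases Nat.mod_two_eq_zero_or_one (a / 2 ^ q) with h | h <;> rw [h]
  · simp [h1]
  · simp

theorem mod_two_pow_of_testBit {a q : ℕ} (h : a.testBit q = true) :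
    a % 2 ^ (q + 1) - 2 ^ q = a % 2 ^ q := by
  rw [Nat.testBit_eq_decide_div_mod_eq, decide_eq_true_iff] at h
  rw [Nat.mod_pow_succ, h]
  omega

theorem mod_two_pow_of_not_testBit {a q : ℕ} (h : a.testBit q = false) :
    a % 2 ^ (q + 1) = a % 2 ^ q := by
  rw [Nat.testBit_eq_decide_div_mod_eq, decide_eq_false_iff_not] at h
  rw [Nat.mod_pow_succ, show a / 2 ^ q % 2 = 0 by omega]
  omega

theorem decode_spec {s : State} (hT : Tables s) {mask : ℕ}
    (hmask : iv s .maskQ (iv s .head 0) = mask) (hlt : mask < 2 ^ s.int 0) :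
    (∀ p < s.int 0, iv (decode.run s) .del p = if mask.testBit p then 1 else 0) ∧
    iv (decode.run s) .cnt 0 = ∑ p ∈ Finset.range (s.int 0), (if mask.testBit p then 1 else 0) ∧
    iv (decode.run s) .wsum 0 =
      ∑ p ∈ Finset.range (s.int 0), (if mask.testBit p then s.int (4 + p) else 0) := by
  obtain ⟨s₁, hs₁⟩ : ∃ s₁, s₁ = EEO.iset (EEO.iset (EEO.iset s .rem 0 mask) .cnt 0 0) .wsum 0 0 :=
    ⟨_, rfl⟩
  have e0 : s₁.int 0 = s.int 0 := by simp [hs₁]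
  have hf₁ : Frame decode s s₁ :=
    hs₁ ▸ ((frame_iset _ _ _ _ _ rfl).trans (frame_iset _ _ _ _ _ rfl)).trans
      (frame_iset _ _ _ _ _ rfl)
  unfold decode
  rw [run, run, run, run, run, run]
  simp only [eval_arr, eval_sca, IExp.eval, hmask]
  rw [← hs₁]
  rw [← e0]
  refine run_forN_induct (fun j s' =>
    (∀ p < s₁.int 0, s₁.int 0 ≤ p + j → iv s' .del p = if mask.testBit p then 1 else 0) ∧
    iv s' .cnt 0 = (∑ i ∈ Finset.range j, if mask.testBit (s₁.int 0 - 1 - i) then 1 else 0) ∧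
    iv s' .wsum 0 = (∑ i ∈ Finset.range j,
      if mask.testBit (s₁.int 0 - 1 - i) then s.int (4 + (s₁.int 0 - 1 - i)) else 0) ∧
    iv s' .rem 0 = mask % 2 ^ (s₁.int 0 - j)) rfl ?_ ?_ |> fun h =>
      ⟨fun p hp => h.1 p hp (by omega), h.2.1.trans (Finset.sum_range_reflect
        (fun p => if mask.testBit p then 1 else 0) _), h.2.2.1.trans (Finset.sum_range_reflect
          (fun p => if mask.testBit p then s.int (4 + p) else 0) _)⟩
  · refine ⟨fun p hp h => by omega, by simp [hs₁], by simp [hs₁], ?_⟩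
    rw [Nat.sub_zero, e0, Nat.mod_eq_of_lt hlt]
    simp [hs₁]
  · rintro j s' hj hf hv ⟨h1, h2, h3, h4⟩
    have hn : s'.int 0 = s₁.int 0 := hf.int_zero
    obtain ⟨q, hq⟩ : ∃ q, q = s₁.int 0 - 1 - j := ⟨_, rfl⟩
    have hq1 : s₁.int 0 - j = q + 1 := by omega
    have hq2 : s₁.int 0 - (j + 1) = q := by omega
    have hpow : iv s' .pow q = 2 ^ q := by
      have := hT.pow q (by omega)
      rw [← hf₁.iv_eq .pow rfl, ← hf.iv_eq .pow rfl] at this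
      exact this
    have hw : s'.int (4 + q) = s.int (4 + q) := by
      rw [hf.int_of_lt _ (by omega), hf₁.int_of_lt _ (by omega)]
    rw [hq1] at h4
    have e1 : (IExp.sub (.sub nExp (.const 1)) (sca .i)).eval s' = q := by
      simp [IExp.eval, hn, hv, hq]
    rw [run, run, e1, IExp.eval, run]
    have hset : ∀ p, s₁.int 0 ≤ p + (j + 1) → p = q ∨ s₁.int 0 ≤ p + j := by omega
    by_cases hb : mask.testBit q = true
    · rw [if_pos (by simp [Test.Holds, hpow, h4, (testBit_iff_two_pow_le_mod mask q).1 hb])]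
      simp only [run, IExp.eval, eval_sca, eval_arr, iv_iset, reduceCtorEq, false_and, and_self,
        if_false, if_true, hpow, h2, h3, h4, mod_two_pow_of_testBit hb]
      rw [int_iset_of_lt (by simp; omega), int_iset_of_lt (by simp; omega),
        int_iset_of_lt (by simp; omega), int_iset_of_lt (by omega), hw]
      refine ⟨fun p hp hpj => ?_, ?_, ?_, by rw [hq2]⟩
      · rcases hset p hpj with rfl | h
        · simp [hb]
        · by_cases hpq : p = q
          · simp [hpq, hb]
          · simp [hpq, h1 p hp h]
      · rw [Finset.sum_range_succ, ← hq, if_pos hb]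
      · rw [Finset.sum_range_succ, ← hq, if_pos hb]
    · rw [if_neg (by
        simp only [Test.Holds, eval_sca, eval_arr, iv_iset, reduceCtorEq, false_and, and_self,
          if_false, if_true, hpow, h4]
        exact mt (testBit_iff_two_pow_le_mod mask q).2 hb)]
      have hb' : mask.testBit q = false := by simpa using hb
      simp only [run, IExp.eval, eval_sca, iv_iset, reduceCtorEq, false_and, and_self,
        if_false, if_true, h2, h3, h4, mod_two_pow_of_not_testBit hb']
      refine ⟨fun p hp hpj => ?_, ?_, ?_, by rw [hq2]⟩
      · rcases hset p hpj with rfl | h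
        · simp [hb']
        · by_cases hpq : p = q
          · simp [hpq, hb']
          · simp [hpq, h1 p hp h]
      · rw [Finset.sum_range_succ, ← hq, if_neg hb, add_zero]
      · rw [Finset.sum_range_succ, ← hq, if_neg hb, add_zero]

theorem resAddr_eval {s : State} (hT : Tables s) {x y : IExp} (hx : x.eval s ≤ s.int 0) :
    (resAddr x y).eval s = s.int 0 * s.int 0 + (x.eval s * s.int 0 + y.eval s) := by
  simp [resAddr, IExp.eval, hT.row _ le_rfl, hT.row _ hx]

theorem resExp_eval {s : State} (hT : Tables s) {x y : IExp} (hx : x.eval s ≤ s.int 0) :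
    (resExp x y).eval s = s.real (s.int 0 * s.int 0 + (x.eval s * s.int 0 + y.eval s)) := by
  rw [resExp, RExp.eval, resAddr_eval hT hx]

theorem colAddr_eval {s : State} (hT : Tables s) {x : IExp} :
    (colAddr x).eval s = s.int 0 * s.int 0 + s.int 0 * s.int 0 + x.eval s := by
  simp [colAddr, IExp.eval, hT.row _ le_rfl]

theorem colExp_eval {s : State} (hT : Tables s) {x : IExp} :
    (colExp x).eval s = s.real (s.int 0 * s.int 0 + s.int 0 * s.int 0 + x.eval s) := by
  rw [colExp, RExp.eval, colAddr_eval hT]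

theorem distExp_eval {s : State} (hT : Tables s) {x y : IExp} (hx : x.eval s ≤ s.int 0) :
    (distExp x y).eval s = s.real (x.eval s * s.int 0 + y.eval s) := by
  simp [distExp, RExp.eval, IExp.eval, hT.row _ hx]

theorem mul_add_lt_mul {n x y : ℕ} (hx : x < n) (hy : y < n) : x * n + y < n * n := by
  nlinarith [Nat.mul_le_mul_right n (Nat.succ_le_of_lt hx)]

/-- `fill e` writes the matrix `val` and changes nothing else in the real memory. When the entry
at `x, y` is computed, the old entries from this one on, and all cells behind the matrix, are
intact. -/
theorem fill_spec {e : RExp} {val : ℕ → ℕ → ℝ} {s : State} (hT : Tables s)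
    (he : ∀ s' x y, x < s.int 0 → y < s.int 0 → Frame (fill e) s s' →
      iv s' .x 0 = x → iv s' .y 0 = y →
      (∀ a, a < s.int 0 * s.int 0 ∨ s.int 0 * s.int 0 + (x * s.int 0 + y) ≤ a →
        s'.real a = s.real a) → e.eval s' = val x y) :
    (∀ x < s.int 0, ∀ y < s.int 0,
      ((fill e).run s).real (s.int 0 * s.int 0 + (x * s.int 0 + y)) = val x y) ∧
    ∀ a, a < s.int 0 * s.int 0 ∨ s.int 0 * s.int 0 + s.int 0 * s.int 0 ≤ a →
      ((fill e).run s).real a = s.real a := by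
  obtain ⟨n, hn⟩ : ∃ n, n = s.int 0 := ⟨_, rfl⟩
  rw [← hn] at he ⊢
  let I : ℕ → State → Prop := fun j s' =>
    (∀ x < n, ∀ y < n, x * n + y < j → s'.real (n * n + (x * n + y)) = val x y) ∧
    ∀ a, a < n * n ∨ n * n + j ≤ a → s'.real a = s.real a
  suffices H : I (n * n) ((fill e).run s) from
    ⟨fun x hx y hy => H.1 x hx y hy (mul_add_lt_mul hx hy), H.2⟩
  nth_rewrite 1 [hn]
  refine run_forN_induct (fun j s' => I (j * n) s') rfl ?_ ?_
  · exact ⟨fun x _ y _ h => by omega, fun a _ => rfl⟩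
  · intro j s₁ hj hf₁ hv₁ hI₁
    have hn₁ : s₁.int 0 = n := by rw [hf₁.int_zero, hn]
    rw [← hn] at hj
    change I ((j + 1) * n) ((Block.forN .y _).run s₁)
    rw [add_mul, one_mul]
    nth_rewrite 2 [← hn₁]
    refine run_forN_induct (fun i s' => I (j * n + i) s') rfl hI₁ ?_
    intro i s₂ hi hf₂ hv₂ hI₂
    rw [hn₁] at hi
    have hf : Frame (fill e) s s₂ := hf₁.trans ⟨hf₂.int_of_lt,
      fun a ha => hf₂.iv_eq a (by simp only [writes, Bool.or_eq_false_iff] at ha ⊢; exact ha.2),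
      fun h => by simp [writesReal] at h⟩
    have hx : iv s₂ .x 0 = j := by rw [hf₂.iv_eq .x rfl, hv₁]
    have hn₂ : s₂.int 0 = n := by rw [hf.int_zero, hn]
    have hval := he s₂ j i hj hi hf hx hv₂ (fun a ha => hI₂.2 a ha)
    have haddr : (resAddr (sca .x) (sca .y)).eval s₂ = n * n + (j * n + i) := by
      rw [resAddr_eval (hT.frame hf rfl rfl) (by rw [eval_sca, hx, hn₂]; omega)]
      simp [hx, hv₂, hn₂]
    rw [run, hval, haddr]
    constructor
    · intro x hx y hy hlt
      rw [real_iset, real_rset]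
      by_cases h : x * n + y = j * n + i
      · rw [if_pos (by rw [h])]
        obtain rfl : y = i := by
          have := congrArg (· % n) h
          simpa [Nat.mod_eq_of_lt hy, Nat.mod_eq_of_lt hi] using this
        obtain rfl : x = j := Nat.eq_of_mul_eq_mul_right (show 0 < n by omega) (by omega)
        rfl
      · rw [if_neg (by omega)]
        exact hI₂.1 x hx y hy (by omega)
    · intro a ha
      rw [real_iset, real_rset, if_neg (by omega)]
      exact hI₂.2 a (by omega)

theorem copyColumn_spec {s : State} (hT : Tables s) {p : ℕ} (hp : iv s .p 0 = p)
    (hlt : p < s.int 0) :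
    (∀ x < s.int 0, (copyColumn.run s).real (s.int 0 * s.int 0 + s.int 0 * s.int 0 + x) =
      s.real (s.int 0 * s.int 0 + (p * s.int 0 + x))) ∧
    ∀ a < s.int 0 * s.int 0 + s.int 0 * s.int 0, (copyColumn.run s).real a = s.real a := by
  obtain ⟨n, hn⟩ : ∃ n, n = s.int 0 := ⟨_, rfl⟩
  rw [← hn] at hlt ⊢
  nth_rewrite 1 [hn]
  refine run_forN_induct (fun j s' =>
    (∀ x < j, s'.real (n * n + n * n + x) = s.real (n * n + (p * n + x))) ∧
    ∀ a < n * n + n * n, s'.real a = s.real a) rfl ⟨fun x hx => by omega, fun a _ => rfl⟩ ?_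
  rintro j s₁ hj hf hv ⟨h1, h2⟩
  have hn₁ : s₁.int 0 = n := by rw [hf.int_zero, hn]
  have hp₁ : iv s₁ .p 0 = p := by rw [hf.iv_eq .p rfl, hp]
  have hT₁ := hT.frame hf rfl rfl
  rw [run, colAddr_eval hT₁, resExp_eval hT₁ (by rw [eval_sca, hp₁, hn₁]; omega)]
  simp only [eval_sca, hv, hp₁, hn₁, real_iset, real_rset]
  refine ⟨fun x hx => ?_, fun a ha => by rw [if_neg (by omega), h2 a ha]⟩
  by_cases hxj : x = j
  · rw [if_pos (by rw [hxj]), hxj]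
    exact h2 _ (by have := mul_add_lt_mul hlt (hn ▸ hj); omega)
  · rw [if_neg (by omega), h1 x (by omega)]

/-! ### Elimination and search for a nonzero residual on the machine -/

/-- The real memory holds the distances `ρ` in the place of the input. -/
def Stores (s : State) (ρ : ℕ → ℕ → ℝ) : Prop :=
  ∀ x < s.int 0, ∀ y < s.int 0, s.real (x * s.int 0 + y) = ρ x y

theorem Stores.of_eq {s s' : State} {ρ : ℕ → ℕ → ℝ} (h : Stores s ρ) (hn : s'.int 0 = s.int 0)
    (hr : ∀ a < s.int 0 * s.int 0, s'.real a = s.real a) : Stores s' ρ := by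
  intro x hx y hy
  rw [hn] at hx hy ⊢
  rw [hr _ (mul_add_lt_mul hx hy), h x hx y hy]

/-- The memory holds the elimination state `E`. Before the origin is chosen, the stored matrix is
meaningless. -/
structure Represents (s : State) (E : Elim) : Prop where
  len : iv s .m 0 = E.pivots.length
  bas : ∀ i < E.pivots.length, iv s .bas i = E.pivots.getD i 0
  res : E.pivots ≠ [] → ∀ x < s.int 0, ∀ y < s.int 0,
    s.real (s.int 0 * s.int 0 + (x * s.int 0 + y)) = E.res x y

theorem addPivot_represents {s : State} {l : List ℕ} {R : ℕ → ℕ → ℝ} {p : ℕ}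
    (hp : iv s .p 0 = p) (hm : iv s .m 0 = l.length)
    (hb : ∀ i < l.length, iv s .bas i = l.getD i 0)
    (hR : ∀ x < s.int 0, ∀ y < s.int 0,
      s.real (s.int 0 * s.int 0 + (x * s.int 0 + y)) = R x y) :
    Represents (addPivot.run s) ⟨l ++ [p], R⟩ := by
  refine ⟨by simp [addPivot, run, IExp.eval, hm], fun i hi => ?_, fun _ => ?_⟩
  · simp only [addPivot, run, IExp.eval, eval_sca, iv_iset, reduceCtorEq, false_and, if_false,
      true_and, hm, hp]
    by_cases h : i = l.length
    · simp [h]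
    · simp only [List.length_append, List.length_singleton] at hi
      rw [if_neg h, hb i (by omega), List.getD_append _ _ _ _ (by omega)]
  · simpa [addPivot, run] using hR

theorem fill_gramExp_spec {s : State} (hT : Tables s) {ρ : ℕ → ℕ → ℝ} (hρ : Stores s ρ) {p : ℕ}
    (hp : iv s .p 0 = p) (hlt : p < s.int 0) :
    (∀ x < s.int 0, ∀ y < s.int 0,
      ((fill gramExp).run s).real (s.int 0 * s.int 0 + (x * s.int 0 + y)) =
        (ρ p x * ρ p x + ρ p y * ρ p y - ρ x y * ρ x y) / 2) ∧
    ∀ a < s.int 0 * s.int 0, ((fill gramExp).run s).real a = s.real a := by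
  have := fill_spec (e := gramExp)
    (val := fun x y => (ρ p x * ρ p x + ρ p y * ρ p y - ρ x y * ρ x y) / 2) hT ?_
  · exact ⟨this.1, fun a ha => this.2 a (Or.inl ha)⟩
  intro s' x y hx hy hf hx' hy' hr
  have hT' := hT.frame hf rfl rfl
  have hρ' := hρ.of_eq hf.int_zero (fun a ha => hr a (Or.inl ha))
  have hp' : iv s' .p 0 = p := by rw [hf.iv_eq .p rfl, hp]
  rw [← hf.int_zero] at hx hy hlt
  simp only [gramExp, RExp.eval]
  rw [distExp_eval hT' (by rw [eval_sca, hp']; omega),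
    distExp_eval hT' (by rw [eval_sca, hp']; omega),
    distExp_eval hT' (by rw [eval_sca, hx']; omega)]
  simp only [eval_sca, hp', hx', hy', hρ' _ hlt _ hx, hρ' _ hlt _ hy, hρ' _ hx _ hy]
  norm_num

theorem fill_schurExp_spec {s : State} (hT : Tables s) {R : ℕ → ℕ → ℝ} {p : ℕ}
    (hR : ∀ x < s.int 0, ∀ y < s.int 0,
      s.real (s.int 0 * s.int 0 + (x * s.int 0 + y)) = R x y)
    (hV : ∀ x < s.int 0, s.real (s.int 0 * s.int 0 + s.int 0 * s.int 0 + x) = R p x)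
    (hp : iv s .p 0 = p) (hlt : p < s.int 0) :
    (∀ x < s.int 0, ∀ y < s.int 0,
      ((fill schurExp).run s).real (s.int 0 * s.int 0 + (x * s.int 0 + y)) =
        R x y - R p x * R p y / R p p) ∧
    ∀ a < s.int 0 * s.int 0, ((fill schurExp).run s).real a = s.real a := by
  have := fill_spec (e := schurExp) (val := fun x y => R x y - R p x * R p y / R p p) hT ?_
  · exact ⟨this.1, fun a ha => this.2 a (Or.inl ha)⟩
  intro s' x y hx hy hf hx' hy' hr
  have hT' := hT.frame hf rfl rfl
  have hp' : iv s' .p 0 = p := by rw [hf.iv_eq .p rfl, hp]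
  have hn := hf.int_zero
  have hxy := mul_add_lt_mul hx hy
  simp only [schurExp, RExp.eval]
  rw [resExp_eval hT' (by rw [eval_sca, hx']; omega), colExp_eval hT', colExp_eval hT',
    colExp_eval hT']
  simp only [eval_sca, hp', hx', hy', hn]
  rw [hr _ (Or.inr le_rfl), hr _ (Or.inr (by omega)), hr _ (Or.inr (by omega)),
    hr _ (Or.inr (by omega)), hR x hx y hy, hV x hx, hV y hy, hV p hlt]

theorem eliminate_spec {s : State} (hT : Tables s) {ρ : ℕ → ℕ → ℝ} (hρ : Stores s ρ)
    {dead : ℕ → Bool} (hdead : ∀ p < s.int 0, iv s .del p = if dead p then 1 else 0) :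
    Represents (eliminate.run s) (elim ρ (s.int 2) dead (s.int 0)) ∧
      ∀ a < s.int 0 * s.int 0, (eliminate.run s).real a = s.real a := by
  set s₀ := EEO.iset s .m 0 0 with hs₀
  have hf₀ : Frame eliminate s s₀ := frame_iset _ _ _ _ _ rfl
  have e0 : s₀.int 0 = s.int 0 := hf₀.int_zero
  unfold eliminate
  rw [run, run]
  simp only [IExp.eval]
  rw [← hs₀]
  nth_rewrite 2 [← e0]
  refine run_forN_induct (fun j s' => Represents s' (elim ρ (s.int 2) dead j) ∧
    ∀ a < s.int 0 * s.int 0, s'.real a = s.real a) rfl ?_ ?_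
  · exact ⟨⟨by simp [elim, hs₀], by simp [elim], by simp [elim]⟩, fun a _ => rfl⟩
  rintro j s' hj hf hv ⟨hE, hr⟩
  have hf' : Frame eliminate s s' := hf₀.trans
    (hf.mono (by intro a; cases a <;> decide) (by decide))
  have hn : s'.int 0 = s.int 0 := hf'.int_zero
  have hd : s'.int 2 = s.int 2 := by
    rw [hf.int_of_lt _ (by omega), hf₀.int_of_lt _ (by omega)]
  rw [e0] at hj
  have hj' : j < s'.int 0 := by rw [hn]; exact hj
  have hT' := hT.frame hf' rfl rfl
  have hρ' := hρ.of_eq hn hr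
  have hdel : iv s' .del j = if dead j then 1 else 0 := by
    rw [hf'.iv_eq .del rfl, hdead j hj]
  -- moving the loop counter is harmless
  have hcount : ∀ t : State, ∀ E : Elim, Represents t E →
      (∀ a < s.int 0 * s.int 0, t.real a = s.real a) →
      Represents (EEO.iset t .p 0 (j + 1)) E ∧
        ∀ a < s.int 0 * s.int 0, (EEO.iset t .p 0 (j + 1)).real a = s.real a := by
    intro t E h ha
    exact ⟨⟨by simpa using h.len, by simpa using h.bas, by simpa using h.res⟩, ha⟩
  rw [elim, Elim.step]
  set E := elim ρ (s.int 2) dead j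
  rw [run]
  by_cases h1 : dead j = true
  · rw [if_neg (by simp [isZero, Test.Holds, IExp.eval, hv, hdel, h1]), if_pos h1]
    exact hcount _ _ hE hr
  rw [if_pos (by simp [isZero, Test.Holds, IExp.eval, hv, hdel, h1]), if_neg h1, run]
  by_cases h2 : E.pivots = []
  · rw [if_pos (by simp [isZero, Test.Holds, IExp.eval, hE.len, h2]), if_pos h2, run]
    obtain ⟨g1, g2⟩ := fill_gramExp_spec hT' hρ' hv hj'
    have hg := frame_run (fill gramExp) s'
    refine hcount _ _ (addPivot_represents (l := []) ?_ ?_ (by simp) ?_) ?_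
    · rw [hg.iv_eq .p rfl, hv]
    · rw [hg.iv_eq .m rfl, hE.len, h2]
    · rw [hg.int_zero]; exact g1
    · intro a ha
      rw [(frame_run addPivot _).real_eq rfl, g2 a (by rwa [hn]), hr a ha]
  have hm : iv s' .m 0 ≠ 0 := by
    rw [hE.len]
    exact mt List.length_eq_zero_iff.1 h2
  rw [if_neg (by simpa [isZero, Test.Holds, IExp.eval] using hm), if_neg h2, run]
  have hpp : (resExp (sca .p) (sca .p)).eval s' = E.res j j := by
    rw [resExp_eval hT' (by rw [eval_sca, hv]; omega), eval_sca, hv, hE.res h2 j hj' j hj']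
  by_cases h3 : 0 < E.res j j ∧ E.pivots.length ≤ s.int 2
  · rw [if_pos (by simpa [Test.Holds, RExp.eval, hpp, hE.len, hd] using h3), if_pos h3, run, run]
    obtain ⟨c1, c2⟩ := copyColumn_spec hT' hv hj'
    have hc := frame_run copyColumn s'
    set t := copyColumn.run s'
    have hnt : t.int 0 = s'.int 0 := hc.int_zero
    have hTt := hT'.frame hc rfl rfl
    have hpt : iv t .p 0 = j := by rw [hc.iv_eq .p rfl, hv]
    obtain ⟨g1, g2⟩ := fill_schurExp_spec (R := E.res) (p := j) hTt (fun x hx y hy => by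
        rw [hnt] at hx hy ⊢
        rw [c2 _ (by have := mul_add_lt_mul hx hy; omega), hE.res h2 x hx y hy])
      (fun x hx => by
        rw [hnt] at hx ⊢
        rw [c1 x hx, hE.res h2 j hj' x hx]) hpt (by rw [hnt]; exact hj')
    have hg := frame_run (fill schurExp) t
    refine hcount _ _ (addPivot_represents ?_ ?_ ?_ ?_) ?_
    · rw [hg.iv_eq .p rfl, hpt]
    · rw [hg.iv_eq .m rfl, hc.iv_eq .m rfl, hE.len]
    · intro i hi
      rw [hg.iv_eq .bas rfl, hc.iv_eq .bas rfl, hE.bas i hi]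
    · rw [hg.int_zero]; exact g1
    · intro a ha
      rw [(frame_run addPivot _).real_eq rfl, g2 a (by rwa [hnt, hn]),
        c2 a (by rw [hn]; omega), hr a ha]
  · rw [if_neg (by simpa [Test.Holds, RExp.eval, hpp, hE.len, hd] using h3), if_neg h3]
    exact hcount _ _ hE hr

theorem search_spec {s : State} (hT : Tables s) {dead : ℕ → Bool} {R : ℕ → ℕ → ℝ}
    (hdead : ∀ p < s.int 0, iv s .del p = if dead p then 1 else 0)
    (hR : ∀ x < s.int 0, dead x = false → ∀ y < s.int 0,
      s.real (s.int 0 * s.int 0 + (x * s.int 0 + y)) = R x y) :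
    (iv (search.run s) .bad 0 = 0 ∧
      ∀ x < s.int 0, ∀ y < s.int 0, dead x = false → dead y = false → R x y = 0) ∨
    (iv (search.run s) .bad 0 = 1 ∧ ∃ x < s.int 0, ∃ y < s.int 0,
      iv (search.run s) .badX 0 = x ∧ iv (search.run s) .badY 0 = y ∧
      dead x = false ∧ dead y = false ∧ R x y ≠ 0) := by
  obtain ⟨n, hn⟩ : ∃ n, n = s.int 0 := ⟨_, rfl⟩
  rw [← hn] at hdead hR ⊢
  let I : (ℕ → ℕ → Prop) → State → Prop := fun A s' =>
    (iv s' .bad 0 = 0 ∧ ∀ x < n, ∀ y < n, A x y → dead x = false → dead y = false → R x y = 0) ∨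
    (iv s' .bad 0 = 1 ∧ ∃ x < n, ∃ y < n, iv s' .badX 0 = x ∧ iv s' .badY 0 = y ∧
      dead x = false ∧ dead y = false ∧ R x y ≠ 0)
  suffices H : I (fun x _ => x < n) (search.run s) by
    rcases H with H | H
    · exact Or.inl ⟨H.1, fun x hx y hy => H.2 x hx y hy hx⟩
    · exact Or.inr H
  have hI : ∀ {A B : ℕ → ℕ → Prop} {s₁ s₂ : State}, I A s₁ →
      (∀ x < n, ∀ y < n, B x y → A x y) →
      (∀ a, a = Var.bad ∨ a = .badX ∨ a = .badY → iv s₂ a 0 = iv s₁ a 0) → I B s₂ := by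
    intro A B s₁ s₂ h hAB hs
    have hb := hs .bad (by simp)
    have hbx := hs .badX (by simp)
    have hby := hs .badY (by simp)
    simp only [I, hb, hbx, hby]
    rcases h with h | h
    · exact Or.inl ⟨h.1, fun x hx y hy hB => h.2 x hx y hy (hAB x hx y hy hB)⟩
    · exact Or.inr h
  set s₀ := EEO.iset s .bad 0 0 with hs₀
  have hf₀ : Frame search s s₀ := frame_iset _ _ _ _ _ rfl
  have e0 : s₀.int 0 = n := by rw [hf₀.int_zero, hn]
  unfold search
  rw [run, run]
  simp only [IExp.eval]
  rw [← hs₀]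
  have main : I (fun x _ => x < s₀.int 0) ((Block.forN .x (.forN .y testCell)).run s₀) := by
    refine run_forN_induct (fun j s' => I (fun x _ => x < j) s') rfl
      (Or.inl ⟨by simp [hs₀], fun x _ y _ h => by omega⟩) ?_
    intro j s₁ hj hf₁ hv₁ hI₁
    rw [e0] at hj
    have hfs₁ : Frame search s s₁ := hf₀.trans
      (hf₁.mono (by intro a; cases a <;> decide) (by decide))
    have hn₁ : s₁.int 0 = n := by rw [hfs₁.int_zero, hn]
    have inner : I (fun x y => x < j ∨ x = j ∧ y < s₁.int 0)
        ((Block.forN .y testCell).run s₁) := ?_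
    · refine hI inner (fun x hx y hy h => by omega) ?_
      rintro a (rfl | rfl | rfl) <;> simp
    refine run_forN_induct (fun i s' => I (fun x y => x < j ∨ x = j ∧ y < i) s') rfl ?_ ?_
    · exact hI hI₁ (fun x _ y _ h => by omega) (by rintro a (rfl | rfl | rfl) <;> simp)
    · intro i s₂ hi hf₂ hv₂ hI₂
      rw [hn₁] at hi
      have hfs₂ : Frame search s s₂ := hfs₁.trans
        (hf₂.mono (by intro a; cases a <;> decide) (by decide))
      have hn₂ : s₂.int 0 = n := by rw [hfs₂.int_zero, hn]
      have hx : iv s₂ .x 0 = j := by rw [hf₂.iv_eq .x rfl, hv₁]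
      have hdx : iv s₂ .del j = if dead j then 1 else 0 := by
        rw [hfs₂.iv_eq .del rfl, hdead j hj]
      have hdy : iv s₂ .del i = if dead i then 1 else 0 := by
        rw [hfs₂.iv_eq .del rfl, hdead i hi]
      have hres : dead j = false → (resExp (sca .x) (sca .y)).eval s₂ = R j i := by
        intro h
        rw [resExp_eval (hT.frame hfs₂ rfl rfl) (by rw [eval_sca, hx, hn₂]; omega), eval_sca,
          eval_sca, hx, hv₂, hn₂, hfs₂.real_eq rfl, hR j hj h i hi]
      rw [testCell, run]
      by_cases hc : dead j = false ∧ dead i = false ∧ R j i ≠ 0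
      · rw [if_pos]
        · refine Or.inr ⟨by simp [run, IExp.eval], j, hj, i, hi, ?_⟩
          simp [run, hx, hv₂, hc, IExp.eval]
        · simp only [Test.Holds, isZero, IExp.eval, RExp.eval, eval_arr, eval_sca, hx, hv₂, hdx,
            hdy, hres hc.1, hc.1, hc.2.1]
          refine ⟨⟨by simp, by simp⟩, fun h => hc.2.2 (le_antisymm ?_ ?_)⟩
          · simpa using h.1
          · simpa using h.2
      · rw [if_neg]
        · rcases hI₂ with h | h
          · left
            refine ⟨by simpa [run] using h.1, fun x hx' y hy' hxy hdx' hdy' => ?_⟩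
            by_cases hxy' : x = j ∧ y = i
            · obtain ⟨rfl, rfl⟩ := hxy'
              by_contra hne
              exact hc ⟨hdx', hdy', hne⟩
            · exact h.2 x hx' y hy' (by omega) hdx' hdy'
          · right
            simpa [run] using h
        · simp only [Test.Holds, isZero, IExp.eval, RExp.eval, eval_arr, eval_sca, hx, hv₂, hdx,
            hdy]
          rintro ⟨⟨h1, h2⟩, h3⟩
          have h1 : dead j = false := by by_contra h; simp [h] at h1
          have h2 : dead i = false := by by_contra h; simp [h] at h2
          rw [hres h1] at h3
          refine hc ⟨h1, h2, fun h0 => h3 ?_⟩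
          simp [h0]
  rwa [e0] at main

/-! ### One round of the main loop -/

/-- All nodes ever put into the queue; the first `head` of them have been processed. -/
def queue (s : State) : List (ℕ × ℕ) :=
  (List.range (iv s .tail 0)).map fun j => (iv s .maskQ j, iv s .forcedQ j)

theorem queue_congr {s s' : State} (ht : iv s' .tail 0 = iv s .tail 0)
    (hm : ∀ j, iv s' .maskQ j = iv s .maskQ j) (hf : ∀ j, iv s' .forcedQ j = iv s .forcedQ j) :
    queue s' = queue s := by
  simp [queue, ht, hm, hf]

theorem queue_frame {p : Block} {s s' : State} (h : Frame p s s') (ht : p.writes .tail = false)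
    (hm : p.writes .maskQ = false) (hf : p.writes .forcedQ = false) : queue s' = queue s :=
  queue_congr (h.iv_eq _ ht _) (h.iv_eq _ hm) (h.iv_eq _ hf)

theorem push_spec {s : State} {a b : IExp} {A B : ℕ} (ha : a.eval s = A)
    (hb : b.eval (EEO.iset s .maskQ (iv s .tail 0) A) = B) :
    queue ((push a b).run s) = queue s ++ [(A, B)] ∧
    ∀ h < iv s .tail 0, h < iv ((push a b).run s) .tail 0 ∧
      iv ((push a b).run s) .maskQ h = iv s .maskQ h ∧
      iv ((push a b).run s) .forcedQ h = iv s .forcedQ h := by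
  have e : (push a b).run s = EEO.iset (EEO.iset (EEO.iset s .maskQ (iv s .tail 0) A)
      .forcedQ (iv s .tail 0) B) .tail 0 (iv s .tail 0 + 1) := by
    simp [push, run, IExp.eval, ha, hb]
  rw [e]
  constructor
  · simp only [queue, iv_iset, reduceCtorEq, false_and, true_and, if_false, if_true,
      List.range_succ, List.map_append, List.map_cons, List.map_nil]
    congr 1
    refine List.map_congr_left fun j hj => ?_
    have := List.mem_range.1 hj
    simp [this.ne]
  · intro h hh
    simp [hh.ne]
    omega

/-- The children of the node `(mask, f)` for pivots `l` and the obstruction at `x, y`. -/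
def children (n mask f : ℕ) (l : List ℕ) (x y : ℕ) : List (ℕ × ℕ) :=
  ((List.range n).filter fun i => f ≤ i ∧ i < l.length).map (fun i => (mask + 2 ^ l.getD i 0, i)) ++
    [(mask + 2 ^ x, l.length + (f - l.length)), (mask + 2 ^ y, l.length + (f - l.length))]

theorem kill_eval {s : State} (hT : Tables s) {q : IExp} (hq : q.eval s ≤ s.int 0) :
    (kill q).eval s = iv s .maskQ (iv s .head 0) + 2 ^ q.eval s := by
  simp [kill, IExp.eval, hT.pow _ hq]

theorem pushChildren_spec {s : State} (hT : Tables s) {mask f : ℕ} {l : List ℕ} {x y : ℕ}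
    (hh : iv s .head 0 < iv s .tail 0) (hmask : iv s .maskQ (iv s .head 0) = mask)
    (hf : iv s .forcedQ (iv s .head 0) = f) (hm : iv s .m 0 = l.length)
    (hbas : ∀ i < l.length, iv s .bas i = l.getD i 0) (hl : ∀ p ∈ l, p < s.int 0)
    (hx : iv s .badX 0 = x) (hy : iv s .badY 0 = y) (hxn : x < s.int 0) (hyn : y < s.int 0) :
    queue (pushChildren.run s) = queue s ++ children (s.int 0) mask f l x y := by
  set C : ℕ → List (ℕ × ℕ) := fun j =>
    ((List.range j).filter fun i => f ≤ i ∧ i < l.length).map (fun i => (mask + 2 ^ l.getD i 0, i))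
    with hC
  set B := Block.forN .i
    (.ite (.and (.ile (arr .forcedQ (sca .head)) (sca .i))
        (.ile (.add (sca .i) (.const 1)) (sca .m)))
      (push (kill (arr .bas (sca .i))) (sca .i))
      .skip) with hB
  let I : List (ℕ × ℕ) → State → Prop := fun L s' => queue s' = queue s ++ L ∧
    iv s' .head 0 < iv s' .tail 0 ∧ iv s' .maskQ (iv s' .head 0) = mask ∧
    iv s' .forcedQ (iv s' .head 0) = f
  have hpush : ∀ {L : List (ℕ × ℕ)} {s₁ : State} {a b : IExp} {A B : ℕ}, I L s₁ → a.eval s₁ = A →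
      b.eval (EEO.iset s₁ .maskQ (iv s₁ .tail 0) A) = B →
      I (L ++ [(A, B)]) ((push a b).run s₁) := by
    rintro L s₁ a b A B ⟨h1, h2, h3, h4⟩ ha hb
    obtain ⟨g1, g2⟩ := push_spec ha hb
    have g := g2 _ h2
    have gh : iv ((push a b).run s₁) .head 0 = iv s₁ .head 0 := (frame_run _ _).iv_eq .head rfl 0
    simp only [I, gh, g1, h1, g, h3, h4, List.append_assoc, and_self]
  have H : I (C (s.int 0)) (B.run s) := by
    refine run_forN_induct (fun j s' => I (C j) s') rfl ?_ ?_
    · refine ⟨?_, by simpa using hh, by simpa using hmask, by simpa using hf⟩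
      simp [hC, queue]
    · intro j s' hj hfr hv hI
      have hrun : I (C (j + 1)) ((Block.ite (.and (.ile (arr .forcedQ (sca .head)) (sca .i))
        (.ile (.add (sca .i) (.const 1)) (sca .m)))
          (push (kill (arr .bas (sca .i))) (sca .i)) .skip).run s') := by
        have hm' : iv s' .m 0 = l.length := by rw [hfr.iv_eq .m rfl, hm]
        have hcj : C (j + 1) = C j ++
            if f ≤ j ∧ j < l.length then [(mask + 2 ^ l.getD j 0, j)] else [] := by
          simp only [hC, List.range_succ, List.filter_append, List.map_append]
          congr 1
          by_cases h : f ≤ j ∧ j < l.length <;> simp [h]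
        rw [run]
        by_cases h : f ≤ j ∧ j < l.length
        · rw [if_pos (by
            simp only [Test.Holds, IExp.eval, eval_arr, eval_sca, hI.2.2.2, hv, hm']
            omega), hcj, if_pos h]
          have hb : iv s' .bas j = l.getD j 0 := by rw [hfr.iv_eq .bas rfl, hbas j h.2]
          have hlt : l.getD j 0 < s.int 0 := by
            rw [List.getD_eq_getElem _ _ h.2]
            exact hl _ (List.getElem_mem _)
          refine hpush hI ?_ ?_
          · have e : (arr .bas (sca .i)).eval s' = l.getD j 0 := by simp [hv, hb]
            rw [kill_eval (hT.frame hfr rfl rfl) (by rw [e, hfr.int_zero]; exact hlt.le), e,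
              hI.2.2.1]
          · simp [hv]
        · rw [if_neg (by
            simp only [Test.Holds, IExp.eval, eval_arr, eval_sca, hI.2.2.2, hv, hm']
            omega), hcj, if_neg h, List.append_nil]
          simpa [run] using hI
      obtain ⟨g1, g2, g3, g4⟩ := hrun
      exact ⟨by rw [← g1]; simp [queue], by simpa using g2, by simpa using g3, by simpa using g4⟩
  have hfB := frame_run B s
  have hT₁ := hT.frame hfB rfl rfl
  have hx₁ : iv (B.run s) .badX 0 = x := by rw [hfB.iv_eq .badX rfl, hx]
  have hy₁ : iv (B.run s) .badY 0 = y := by rw [hfB.iv_eq .badY rfl, hy]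
  have hm₁ : iv (B.run s) .m 0 = l.length := by rw [hfB.iv_eq .m rfl, hm]
  have hn₁ := hfB.int_zero
  have e : pushChildren.run s =
    (push (kill (sca .badY)) (.add (sca .m) (.sub (arr .forcedQ (sca .head)) (sca .m)))).run
    ((push (kill (sca .badX)) (.add (sca .m) (.sub (arr .forcedQ (sca .head)) (sca .m)))).run
      (B.run s)) := rfl
  have hforced : ∀ {s₁ : State} (A : ℕ) {L}, I L s₁ → iv s₁ .m 0 = l.length →
      (IExp.add (sca .m) (.sub (arr .forcedQ (sca .head)) (sca .m))).eval
        (EEO.iset s₁ .maskQ (iv s₁ .tail 0) A) = l.length + (f - l.length) := by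
    intro s₁ A L hI h
    simp [IExp.eval, h, hI.2.2.2]
  rw [e]
  have H1 := hpush (a := kill (sca .badX)) (A := mask + 2 ^ x) H
    (by rw [kill_eval hT₁ (by rw [eval_sca, hx₁, hn₁]; exact hxn.le), H.2.2.1, eval_sca, hx₁])
    (hforced _ H hm₁)
  set s₂ := (push (kill (sca .badX))
    (.add (sca .m) (.sub (arr .forcedQ (sca .head)) (sca .m)))).run (B.run s)
  have hf₂ : Frame _ (B.run s) s₂ := frame_run _ _
  have H2 := hpush (a := kill (sca .badY)) (A := mask + 2 ^ y) H1
    (by rw [kill_eval (hT₁.frame hf₂ rfl rfl)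
          (by rw [eval_sca, hf₂.iv_eq .badY rfl, hy₁, hf₂.int_zero, hn₁]; exact hyn.le),
        H1.2.2.1, eval_sca, hf₂.iv_eq .badY rfl, hy₁])
    (hforced _ H1 (by rw [hf₂.iv_eq .m rfl, hm₁]))
  rw [H2.1, children, List.append_assoc]
  rfl

/-- One round either finds that the alive points embed and tests the budgets, or finds an
obstruction and appends the children. -/
theorem processNode_spec {s : State} (hT : Tables s) {ρ : ℕ → ℕ → ℝ} (hρ : Stores s ρ)
    {mask f : ℕ} (hh : iv s .head 0 < iv s .tail 0)
    (hmask : iv s .maskQ (iv s .head 0) = mask) (hforced : iv s .forcedQ (iv s .head 0) = f)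
    (hlt : mask < 2 ^ s.int 0) (hfound : iv s .found 0 = 0) {E : Elim}
    (hE : elim ρ (s.int 2) mask.testBit (s.int 0) = E) {c w : ℕ}
    (hc : (∑ p ∈ Finset.range (s.int 0), if mask.testBit p then 1 else 0) = c)
    (hw : (∑ p ∈ Finset.range (s.int 0), if mask.testBit p then s.int (4 + p) else 0) = w) :
    Stores (processNode.run s) ρ ∧ iv (processNode.run s) .head 0 = iv s .head 0 + 1 ∧
    (((∀ x < s.int 0, ∀ y < s.int 0, mask.testBit x = false → mask.testBit y = false →
        E.res x y = 0) ∧ queue (processNode.run s) = queue s ∧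
        iv (processNode.run s) .found 0 = if c ≤ s.int 1 ∧ w ≤ s.int 3 then 1 else 0) ∨
      ∃ x < s.int 0, ∃ y < s.int 0, mask.testBit x = false ∧ mask.testBit y = false ∧
        E.res x y ≠ 0 ∧ iv (processNode.run s) .found 0 = 0 ∧
        queue (processNode.run s) = queue s ++
          if c + 1 ≤ s.int 1 then children (s.int 0) mask f E.pivots x y else []) := by
  obtain ⟨n, hn⟩ : ∃ n, n = s.int 0 := ⟨_, rfl⟩
  obtain ⟨k, hk⟩ : ∃ k, k = s.int 1 := ⟨_, rfl⟩
  obtain ⟨W, hW⟩ : ∃ W, W = s.int 3 := ⟨_, rfl⟩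
  obtain ⟨a1, a2, a3⟩ := decode_spec hT hmask hlt
  rw [hc] at a2
  rw [hw] at a3
  have hfa := frame_run decode s
  set sa := decode.run s
  have hTa := hT.frame hfa rfl rfl
  have hna := hfa.int_zero
  have hρa : Stores sa ρ := hρ.of_eq hna fun a _ => by rw [hfa.real_eq rfl]
  obtain ⟨b1, b2⟩ := eliminate_spec hTa hρa (dead := mask.testBit) (by rwa [hna])
  rw [hna, hfa.int_of_lt 2 (by omega), hE] at b1
  have hfb := frame_run eliminate sa
  set sb := eliminate.run sa
  have hTb := hTa.frame hfb rfl rfl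
  have hnb : sb.int 0 = s.int 0 := hfb.int_zero.trans hna
  have hρb : Stores sb ρ := hρa.of_eq hfb.int_zero b2
  have hdelb : ∀ p < sb.int 0, iv sb .del p = if mask.testBit p then 1 else 0 := by
    intro p hp
    rw [hfb.iv_eq .del rfl, a1 p (hnb ▸ hp)]
  have c1 := search_spec (R := E.res) hTb hdelb (by
    intro x hx hxd y hy
    refine b1.res ?_ x hx y hy
    intro h0
    rw [← hE] at h0
    have := dead_of_pivots_eq_nil h0 (hnb ▸ hx)
    rw [hxd] at this
    exact Bool.false_ne_true this)
  have hfc := frame_run search sb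
  set sc := search.run sb
  have hTc := hTb.frame hfc rfl rfl
  have hnc : sc.int 0 = s.int 0 := hfc.int_zero.trans hnb
  have hρc : Stores sc ρ := hρb.of_eq hfc.int_zero fun a _ => by rw [hfc.real_eq rfl]
  rw [hnb] at c1
  have hlow : ∀ j < s.int 0 + 4, sc.int j = s.int j := by
    intro j hj
    rw [hfc.int_of_lt j (by omega), hfb.int_of_lt j (by omega), hfa.int_of_lt j hj]
  have hhist : queue sc = queue s := by
    rw [queue_frame hfc rfl rfl rfl, queue_frame hfb rfl rfl rfl, queue_frame hfa rfl rfl rfl]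
  have hkeep : ∀ a, decode.writes a = false → eliminate.writes a = false →
      search.writes a = false → ∀ i, iv sc a i = iv s a i := by
    intro a h1 h2 h3 i
    rw [hfc.iv_eq a h3, hfb.iv_eq a h2, hfa.iv_eq a h1]
  have hfoundc : iv sc .found 0 = 0 := by rw [hkeep .found rfl rfl rfl, hfound]
  have hcnt : iv sc .cnt 0 = c := by rw [hfc.iv_eq .cnt rfl, hfb.iv_eq .cnt rfl, a2]
  have hwsum : iv sc .wsum 0 = w := by rw [hfc.iv_eq .wsum rfl, hfb.iv_eq .wsum rfl, a3]
  have hm : iv sc .m 0 = E.pivots.length := by rw [hfc.iv_eq .m rfl, b1.len]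
  have hbas : ∀ i < E.pivots.length, iv sc .bas i = E.pivots.getD i 0 := by
    intro i hi
    rw [hfc.iv_eq .bas rfl, b1.bas i hi]
  have hfd := frame_run branch sc
  have e : processNode.run s = EEO.iset (branch.run sc) .head 0 (iv s .head 0 + 1) := by
    have : iv (branch.run sc) .head 0 = iv s .head 0 := by
      rw [hfd.iv_eq .head rfl, hkeep .head rfl rfl rfl]
    rw [← this]
    simp [processNode, run, IExp.eval, sc, sb, sa]
  rw [e]
  have hh' : ∀ v, queue (EEO.iset (branch.run sc) .head 0 v) = queue (branch.run sc) := by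
    intro v
    simp [queue]
  refine ⟨?_, by simp, ?_⟩
  · refine hρc.of_eq (by rw [int_zero_iset, hfd.int_zero]) fun a _ => ?_
    rw [real_iset, hfd.real_eq rfl]
  rw [hh']
  simp only [iv_iset, reduceCtorEq, false_and, if_false]
  rcases c1 with ⟨hbad, hz⟩ | ⟨hbad, x, hx, y, hy, hbx, hby, hxd, hyd, hne⟩
  · left
    refine ⟨hz, ?_⟩
    rw [branch, run, if_pos (by simp [isZero, Test.Holds, IExp.eval, hbad]), run]
    by_cases h : c ≤ s.int 1 ∧ w ≤ s.int 3
    · rw [if_pos (by simpa [Test.Holds, hcnt, hwsum, hlow] using h), if_pos h]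
      refine ⟨?_, by simp [run, IExp.eval]⟩
      rw [← hhist]
      simp [queue, run]
    · rw [if_neg (by simpa [Test.Holds, hcnt, hwsum, hlow] using h), if_neg h]
      exact ⟨hhist, hfoundc⟩
  · right
    refine ⟨x, hx, y, hy, hxd, hyd, hne, ?_⟩
    rw [branch, run, if_neg (by simp [isZero, Test.Holds, IExp.eval, hbad]), run]
    by_cases h : c + 1 ≤ s.int 1
    · rw [if_pos (by simpa [Test.Holds, IExp.eval, hcnt, hlow] using h), if_pos h]
      refine ⟨by rw [(frame_run pushChildren sc).iv_eq .found rfl, hfoundc], ?_⟩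
      have hhead : iv sc .head 0 = iv s .head 0 := hkeep .head rfl rfl rfl 0
      rw [← hhist, ← hnc]
      refine pushChildren_spec hTc ?_ ?_ ?_ hm hbas ?_ hbx hby (by rwa [hnc]) (by rwa [hnc])
      · rw [hhead, hkeep .tail rfl rfl rfl]
        exact hh
      · rw [hhead, hkeep .maskQ rfl rfl rfl, hmask]
      · rw [hhead, hkeep .forcedQ rfl rfl rfl, hforced]
      · intro p hp
        rw [hnc]
        rw [← hE] at hp
        exact (lt_and_alive_of_mem_pivots hp).1
    · rw [if_neg (by simpa [Test.Holds, IExp.eval, hcnt, hlow] using h), if_neg h]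
      exact ⟨hfoundc, by simpa [run] using hhist⟩

theorem testBit_add_two_pow {a q : ℕ} (h : a.testBit q = false) (p : ℕ) :
    (a + 2 ^ q).testBit p = (a.testBit p || decide (p = q)) := by
  have h1 : a % 2 ^ (q + 1) = a % 2 ^ q := mod_two_pow_of_not_testBit h
  have hlt : a % 2 ^ q < 2 ^ q := Nat.mod_lt _ (by positivity)
  have hp := Nat.pow_succ 2 q
  have e1 : a = 2 ^ (q + 1) * (a / 2 ^ (q + 1)) + a % 2 ^ q := by
    rw [← h1, Nat.div_add_mod]
  have e2 : a + 2 ^ q = 2 ^ (q + 1) * (a / 2 ^ (q + 1)) + (2 ^ q + a % 2 ^ q) := by omega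
  rw [e2]
  conv_rhs => rw [e1]
  rw [Nat.testBit_two_pow_mul_add _ (by omega), Nat.testBit_two_pow_mul_add _ (by omega)]
  by_cases hpq : p < q + 1
  · simp only [hpq, if_true]
    rcases Nat.lt_succ_iff_lt_or_eq.1 hpq with hlt' | rfl
    · rw [Nat.testBit_two_pow_add_gt hlt']
      simp [hlt'.ne]
    · rw [Nat.testBit_two_pow_add_eq, Nat.testBit_lt_two_pow hlt]
      simp
  · simp [hpq, show p ≠ q by omega]

/-! ### The search tree: correctness and size -/

section Instance

variable (I : EEOInstance)

/-- The distance of the instance, on natural numbers, with value `0` outside of the points. -/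
def pointDist (x y : ℕ) : ℝ :=
  if h : x < I.n ∧ y < I.n then I.space.rho ⟨x, h.1⟩ ⟨y, h.2⟩ else 0

theorem pointDist_nonneg (x y : ℕ) : 0 ≤ pointDist I x y := by
  unfold pointDist
  split_ifs
  · exact I.space.rho_nonneg _ _
  · exact le_rfl

theorem pointDist_self (x : ℕ) : pointDist I x x = 0 := by
  unfold pointDist
  split_ifs
  · exact I.space.rho_self _
  · rfl

theorem pointDist_coe (x y : Fin I.n) : pointDist I x y = I.space.rho x y := by
  simp [pointDist]

/-- The completed elimination at a node with the given mask. -/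
noncomputable def nodeElim (mask : ℕ) : Elim := elim (pointDist I) I.d mask.testBit I.n

/-- The weight of the instance, on natural numbers. -/
def weightOf (p : ℕ) : ℕ := if h : p < I.n then I.weight ⟨p, h⟩ else 0

/-- The set of points deleted by a mask. -/
def deleted (mask : ℕ) : Finset (Fin I.n) := Finset.univ.filter fun i => mask.testBit i

theorem mem_deleted {mask : ℕ} {i : Fin I.n} : i ∈ deleted I mask ↔ mask.testBit i = true := by
  simp [deleted]

theorem card_deleted (mask : ℕ) :
    (∑ p ∈ Finset.range I.n, if mask.testBit p then 1 else 0) = (deleted I mask).card := by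
  rw [Finset.sum_range, deleted, Finset.card_filter]

theorem weight_deleted (mask : ℕ) :
    (∑ p ∈ Finset.range I.n, if mask.testBit p then weightOf I p else 0) =
      ∑ i ∈ deleted I mask, I.weight i := by
  rw [Finset.sum_range, deleted, Finset.sum_filter]
  simp [weightOf]

theorem deleted_zero : deleted I 0 = ∅ := by
  ext i
  simp [mem_deleted]

theorem deleted_kill {mask : ℕ} {u : Fin I.n} (h : mask.testBit u = false) :
    deleted I (mask + 2 ^ (u : ℕ)) = insert u (deleted I mask) := by
  ext i
  rw [mem_deleted, testBit_add_two_pow h, Finset.mem_insert, mem_deleted]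
  simp [Fin.ext_iff, or_comm]

theorem card_deleted_kill {mask q : ℕ} (hq : q < I.n) (h : mask.testBit q = false) :
    (deleted I (mask + 2 ^ q)).card = (deleted I mask).card + 1 := by
  have := deleted_kill I (u := ⟨q, hq⟩) h
  rw [this, Finset.card_insert_of_notMem]
  simp [mem_deleted, h]

theorem card_deleted_lt {mask q : ℕ} (hq : q < I.n) (h : mask.testBit q = false) :
    (deleted I mask).card < I.n := by
  have := card_deleted_kill I hq h
  have h2 := Finset.card_le_univ (deleted I (mask + 2 ^ q))
  rw [Fintype.card_fin] at h2
  omega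

/-- Some solution contains the deleted points of the node `v = (mask, f)` and none of its first
`f` pivots. -/
def Good (v : ℕ × ℕ) : Prop :=
  ∃ O : Finset (Fin I.n), O.card ≤ I.k ∧ ∑ x ∈ O, I.weight x ≤ I.W ∧
    (I.space.restrict {x | x ∉ O}).Embeddable I.d ∧ deleted I v.1 ⊆ O ∧
    ∀ i ∈ O, (i : ℕ) ∉ (nodeElim I v.1).pivots.take v.2

theorem good_root (h : I.IsYes) : Good I (0, 0) := by
  obtain ⟨O, h1, h2, h3⟩ := h
  exact ⟨O, h1, h2, h3, by simp [deleted_zero], by simp⟩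

theorem budget_of_good {v : ℕ × ℕ} (h : Good I v) :
    (deleted I v.1).card ≤ I.k ∧ ∑ i ∈ deleted I v.1, I.weight i ≤ I.W := by
  obtain ⟨O, h1, h2, -, h3, -⟩ := h
  exact ⟨(Finset.card_le_card h3).trans h1,
    (Finset.sum_le_sum_of_subset h3).trans h2⟩

theorem isYes_of_res_eq_zero {mask : ℕ}
    (hz : ∀ x < I.n, ∀ y < I.n, mask.testBit x = false → mask.testBit y = false →
      (nodeElim I mask).res x y = 0)
    (hc : (deleted I mask).card ≤ I.k) (hw : ∑ i ∈ deleted I mask, I.weight i ≤ I.W) :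
    I.IsYes := by
  obtain ⟨φ, hφ⟩ := embedding_of_res_eq_zero (d := I.d) (dead := mask.testBit)
    (pointDist_nonneg I) (pointDist_self I) I.n (fun x y hx hy => hz x hx y hy)
  refine ⟨deleted I mask, hc, hw, fun x => φ x.1, fun x y => ?_⟩
  have halive : ∀ x : {x | x ∉ deleted I mask}, mask.testBit x.1 = false := fun x => by
    have := x.2
    simpa [mem_deleted] using this
  rw [← hφ _ _ x.1.2 y.1.2 (halive x) (halive y), pointDist_coe]
  rfl

/-- A set whose complement embeds contains a point of every obstruction. -/
theorem exists_mem_of_res_ne_zero {mask x y : ℕ} {O : Finset (Fin I.n)}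
    (hO : (I.space.restrict {x | x ∉ O}).Embeddable I.d) (hx : x < I.n) (hy : y < I.n)
    (hxd : mask.testBit x = false) (hne : (nodeElim I mask).res x y ≠ 0) :
    ∃ u ∈ O, (u : ℕ) ∈ (nodeElim I mask).pivots ∨ (u : ℕ) = x ∨ (u : ℕ) = y := by
  classical
  by_contra! hcon
  obtain ⟨ψ, hψ⟩ := hO
  let S : Set ℕ := {u | ∃ hu : u < I.n, (⟨u, hu⟩ : Fin I.n) ∉ O}
  let φ : ℕ → EuclideanSpace ℝ (Fin I.d) := fun u =>
    if h : ∃ hu : u < I.n, (⟨u, hu⟩ : Fin I.n) ∉ O then ψ ⟨⟨u, h.1⟩, h.2⟩ else 0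
  apply hne
  refine res_eq_zero_of_embedding (S := S) (φ := φ) ?_ ?_ ?_ ?_ hx hxd
  · rintro u ⟨hu, hu'⟩ v ⟨hv, hv'⟩
    have := hψ ⟨⟨u, hu⟩, hu'⟩ ⟨⟨v, hv⟩, hv'⟩
    simp only [φ]
    rw [dif_pos ⟨hu, hu'⟩, dif_pos ⟨hv, hv'⟩, ← this]
    exact pointDist_coe I ⟨u, hu⟩ ⟨v, hv⟩
  · intro p hp
    have hpn := (lt_and_alive_of_mem_pivots hp).1
    exact ⟨hpn, fun hpO => (hcon _ hpO).1 hp⟩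
  · exact ⟨hx, fun hO => (hcon _ hO).2.1 rfl⟩
  · exact ⟨hy, fun hO => (hcon _ hO).2.2 rfl⟩

theorem take_pivots_kill {mask q : ℕ} (hq : mask.testBit q = false) {j : ℕ}
    (hp : q ∉ (nodeElim I mask).pivots.take j) :
    (nodeElim I (mask + 2 ^ q)).pivots.take j = (nodeElim I mask).pivots.take j :=
  take_pivots_of_kill (testBit_add_two_pow hq) I.n j hp

/-- Branching is complete: if a solution extends a node that has an obstruction, then it extends
the child for the first pivot that it deletes or, if it deletes none, a child for `x` or `y`. -/
theorem exists_good_child {mask f x y : ℕ} (hg : Good I (mask, f)) (hx : x < I.n) (hy : y < I.n)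
    (hxd : mask.testBit x = false) (hyd : mask.testBit y = false)
    (hne : (nodeElim I mask).res x y ≠ 0) :
    (deleted I mask).card + 1 ≤ I.k ∧
      ∃ v ∈ children I.n mask f (nodeElim I mask).pivots x y, Good I v := by
  obtain ⟨O, h1, h2, h3, h4, h5⟩ := hg
  obtain ⟨u, huO, hu⟩ := exists_mem_of_res_ne_zero I h3 hx hy hxd hne
  set l := (nodeElim I mask).pivots with hl
  have hlen : l.length ≤ I.n := (length_pivots_le I.n).1
  have hchild : ∀ u ∈ O, mask.testBit u = false → ∀ j, (∀ i ∈ O, (i : ℕ) ∉ l.take j) →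
      Good I (mask + 2 ^ (u : ℕ), j) := by
    intro u huO hud j hj
    refine ⟨O, h1, h2, h3, ?_, ?_⟩
    · rw [deleted_kill I hud]
      exact Finset.insert_subset huO h4
    · rw [take_pivots_kill I hud (hj u huO)]
      exact hj
  constructor
  · have hud : mask.testBit u = false := by
      rcases hu with hu | hu | hu
      · exact (lt_and_alive_of_mem_pivots hu).2
      · rw [hu, hxd]
      · rw [hu, hyd]
    rw [← card_deleted_kill I u.2 hud, deleted_kill I hud]
    exact (Finset.card_le_card (Finset.insert_subset huO h4)).trans h1
  · -- the first pivot in `O`, if there is one, gives the child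
    by_cases hpiv : ∃ j, ∃ h : j < l.length, ∃ i ∈ O, (i : ℕ) = l[j]
    · classical
      obtain ⟨hj, i, hiO, hi⟩ := Nat.find_spec hpiv
      have hmin : ∀ i ∈ O, (i : ℕ) ∉ l.take (Nat.find hpiv) := by
        intro i hi hmem
        obtain ⟨r, hr, hri⟩ := List.mem_take_iff_getElem.1 hmem
        have hr' : r < Nat.find hpiv := by omega
        exact Nat.find_min hpiv hr' ⟨by omega, i, hi, hri.symm⟩
      set j := Nat.find hpiv
      have hfj : f ≤ j := by
        by_contra! hlt
        refine h5 i hiO ?_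
        rw [hi]
        exact List.mem_take_iff_getElem.2 ⟨j, by omega, rfl⟩
      have hid : mask.testBit i = false :=
        (lt_and_alive_of_mem_pivots (hi ▸ List.getElem_mem hj : (i : ℕ) ∈ l)).2
      refine ⟨(mask + 2 ^ (i : ℕ), j), ?_, hchild i hiO hid j hmin⟩
      refine List.mem_append_left _ (List.mem_map.2 ⟨j, ?_, ?_⟩)
      · rw [List.mem_filter, List.mem_range]
        exact ⟨by omega, by simp [hfj, hj]⟩
      · rw [List.getD_eq_getElem _ _ hj, ← hi]
    · have hnot : ∀ i ∈ O, (i : ℕ) ∉ l := by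
        intro i hi hmem
        obtain ⟨r, hr, hri⟩ := List.getElem_of_mem hmem
        exact hpiv ⟨r, hr, i, hi, hri.symm⟩
      have hnot' : ∀ j, ∀ i ∈ O, (i : ℕ) ∉ l.take j := fun j i hi hmem =>
        hnot i hi (List.mem_of_mem_take hmem)
      rcases hu with hu | hu | hu
      · exact absurd hu (hnot u huO)
      · refine ⟨_, List.mem_append_right _ (List.mem_cons_self ..), ?_⟩
        rw [← hu]
        exact hchild u huO (by rw [hu, hxd]) _ (hnot' _)
      · refine ⟨_, List.mem_append_right _ (List.mem_cons_of_mem _ (List.mem_cons_self ..)), ?_⟩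
        rw [← hu]
        exact hchild u huO (by rw [hu, hyd]) _ (hnot' _)

theorem of_mem_children {n mask f x y : ℕ} {l : List ℕ} {v : ℕ × ℕ}
    (hv : v ∈ children n mask f l x y) : ∃ q, (q ∈ l ∨ q = x ∨ q = y) ∧ v.1 = mask + 2 ^ q := by
  simp only [children, List.mem_append, List.mem_map, List.mem_filter, decide_eq_true_eq,
    List.mem_cons, List.not_mem_nil, or_false] at hv
  rcases hv with ⟨i, ⟨-, -, hi⟩, rfl⟩ | rfl | rfl
  · exact ⟨_, Or.inl (by rw [List.getD_eq_getElem _ _ hi]; exact List.getElem_mem hi), rfl⟩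
  · exact ⟨x, by simp, rfl⟩
  · exact ⟨y, by simp, rfl⟩

/-- An upper bound for the number of nodes of the subtree below a node: its depth times its
number of leaves. -/
def potential (v : ℕ × ℕ) : ℕ :=
  (I.n - (deleted I v.1).card + 1) *
    min ((I.d + 3) ^ (I.k - (deleted I v.1).card))
      (2 ^ (I.k - (deleted I v.1).card + (I.d + 1 - v.2)))

theorem potential_pos (v : ℕ × ℕ) : 1 ≤ potential I v :=
  Nat.mul_pos (by omega) (lt_min (by positivity) (by positivity))

/-- The powers of two for the children of a node with `f` kept pivots out of `m` add up to the
power for the node itself. -/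
theorem sum_two_pow_add (a D : ℕ) {f m : ℕ} (hfm : f ≤ m) (hm : m ≤ D) :
    ∑ i ∈ Finset.Ico f m, 2 ^ (a + (D - i)) + 2 ^ (a + (D - m) + 1) = 2 ^ (a + 1 + (D - f)) := by
  induction m, hfm using Nat.le_induction with
  | base => simp [add_right_comm]
  | succ m hfm ih =>
    rw [← ih (by omega), Finset.sum_Ico_succ_top hfm,
      show a + (D - (m + 1)) + 1 = a + (D - m) by omega, pow_succ]
    ring

theorem sum_children (n mask f : ℕ) (l : List ℕ) (hl : l.length ≤ n) (x y : ℕ) (g : ℕ × ℕ → ℕ) :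
    ((children n mask f l x y).map g).sum =
      ∑ i ∈ Finset.Ico f l.length, g (mask + 2 ^ l.getD i 0, i) +
        (g (mask + 2 ^ x, l.length + (f - l.length)) +
          g (mask + 2 ^ y, l.length + (f - l.length))) := by
  have H : ∀ (h : ℕ → ℕ) (P : ℕ → Bool) (n : ℕ), (((List.range n).filter P).map h).sum =
      ∑ i ∈ (Finset.range n).filter (fun i => P i = true), h i := by
    intro h P n
    simp [Finset.sum, Finset.filter, Finset.range, Multiset.range]
  simp only [children, List.map_append, List.sum_append, List.map_map]
  rw [H]
  congr 1
  · refine Finset.sum_congr ?_ fun _ _ => rfl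
    ext i
    simp only [Finset.mem_filter, Finset.mem_range, Finset.mem_Ico, decide_eq_true_eq]
    omega

theorem potential_children {mask f x y : ℕ} (hx : x < I.n) (hy : y < I.n)
    (hxd : mask.testBit x = false) (hyd : mask.testBit y = false)
    (hk : (deleted I mask).card + 1 ≤ I.k) :
    ((children I.n mask f (nodeElim I mask).pivots x y).map (potential I)).sum + 1 ≤
      potential I (mask, f) := by
  set l := (nodeElim I mask).pivots with hl
  obtain ⟨hln, hld⟩ : l.length ≤ I.n ∧ l.length ≤ I.d + 1 := length_pivots_le I.n
  have hcn := card_deleted_lt I hx hxd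
  rw [sum_children _ _ _ _ hln]
  obtain ⟨r, hr⟩ : ∃ r, I.n - (deleted I mask).card = r := ⟨_, rfl⟩
  obtain ⟨a, ha⟩ : ∃ a, I.k - (deleted I mask).card = a + 1 :=
    ⟨I.k - (deleted I mask).card - 1, by omega⟩
  have hchild : ∀ q j, q < I.n → mask.testBit q = false → potential I (mask + 2 ^ q, j) =
      r * min ((I.d + 3) ^ a) (2 ^ (a + (I.d + 1 - j))) := by
    intro q j hq hqd
    rw [potential, card_deleted_kill I hq hqd,
      show I.n - ((deleted I mask).card + 1) + 1 = r by omega,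
      show I.k - ((deleted I mask).card + 1) = a by omega]
  have hpiv : ∑ i ∈ Finset.Ico f l.length, potential I (mask + 2 ^ l.getD i 0, i) =
      ∑ i ∈ Finset.Ico f l.length, r * min ((I.d + 3) ^ a) (2 ^ (a + (I.d + 1 - i))) := by
    refine Finset.sum_congr rfl fun i hi => ?_
    have hil := (Finset.mem_Ico.1 hi).2
    have hmem : l.getD i 0 ∈ l := by
      rw [List.getD_eq_getElem _ _ hil]
      exact List.getElem_mem hil
    obtain ⟨g1, g2⟩ := lt_and_alive_of_mem_pivots hmem
    exact hchild _ _ g1 g2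
  rw [hpiv, hchild x _ hx hxd, hchild y _ hy hyd, ← Finset.mul_sum, ← mul_add, ← mul_add]
  set f' := l.length + (f - l.length) with hf'
  have hX : ∑ i ∈ Finset.Ico f l.length, min ((I.d + 3) ^ a) (2 ^ (a + (I.d + 1 - i))) +
      (min ((I.d + 3) ^ a) (2 ^ (a + (I.d + 1 - f'))) +
        min ((I.d + 3) ^ a) (2 ^ (a + (I.d + 1 - f')))) ≤ (I.d + 3) ^ (a + 1) := by
    have h1 := Finset.sum_le_card_nsmul (Finset.Ico f l.length)
      (fun i => min ((I.d + 3) ^ a) (2 ^ (a + (I.d + 1 - i)))) ((I.d + 3) ^ a)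
      (fun i _ => min_le_left _ _)
    have h2 : min ((I.d + 3) ^ a) (2 ^ (a + (I.d + 1 - f'))) ≤ (I.d + 3) ^ a := min_le_left _ _
    rw [Nat.card_Ico, smul_eq_mul] at h1
    have h3 : (l.length - f) * (I.d + 3) ^ a ≤ (I.d + 1) * (I.d + 3) ^ a :=
      Nat.mul_le_mul_right _ (by omega)
    have h4 : (I.d + 3) ^ (a + 1) = (I.d + 1) * (I.d + 3) ^ a + 2 * (I.d + 3) ^ a := by ring
    omega
  have hY : ∑ i ∈ Finset.Ico f l.length, min ((I.d + 3) ^ a) (2 ^ (a + (I.d + 1 - i))) +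
      (min ((I.d + 3) ^ a) (2 ^ (a + (I.d + 1 - f'))) +
        min ((I.d + 3) ^ a) (2 ^ (a + (I.d + 1 - f')))) ≤ 2 ^ (a + 1 + (I.d + 1 - f)) := by
    have h1 : ∑ i ∈ Finset.Ico f l.length, min ((I.d + 3) ^ a) (2 ^ (a + (I.d + 1 - i))) ≤
        ∑ i ∈ Finset.Ico f l.length, 2 ^ (a + (I.d + 1 - i)) :=
      Finset.sum_le_sum fun i _ => min_le_right _ _
    have h2 : min ((I.d + 3) ^ a) (2 ^ (a + (I.d + 1 - f'))) ≤ 2 ^ (a + (I.d + 1 - f')) :=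
      min_le_right _ _
    have h3 : 2 ^ (a + (I.d + 1 - f') + 1) =
      2 ^ (a + (I.d + 1 - f')) + 2 ^ (a + (I.d + 1 - f')) := by ring
    -- in the second case no pivot is free, and only the children for `x` and `y` count
    rcases le_total f l.length with hfl | hfl
    · have h4 := sum_two_pow_add a (I.d + 1) hfl hld
      rw [show f' = l.length by omega] at *
      omega
    · have e : Finset.Ico f l.length = ∅ := Finset.Ico_eq_empty (by omega)
      rw [e] at h1 ⊢
      rw [show f' = f by omega] at *
      rw [show a + 1 + (I.d + 1 - f) = a + (I.d + 1 - f) + 1 by omega, h3]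
      simp only [Finset.sum_empty] at h1 ⊢
      omega
  rw [potential, hr, ha, add_mul, one_mul]
  have hpos : 0 < min ((I.d + 3) ^ (a + 1)) (2 ^ (a + 1 + (I.d + 1 - f))) :=
    lt_min (by positivity) (by positivity)
  have := Nat.mul_le_mul_left r (le_min hX hY)
  simp only at this ⊢
  omega

/-! ### The main loop -/

/-- The invariant of the main loop. A yes-instance has been recognized or has a solution that
extends a pending node. -/
structure LoopInv (s : State) : Prop where
  int_eq : ∀ j < I.n + 4, s.int j = I.encode.int j
  tables : Tables s
  stores : Stores s (pointDist I)
  head_le : iv s .head 0 ≤ iv s .tail 0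
  mask_lt : ∀ v ∈ queue s, v.1 < 2 ^ I.n
  found_le : iv s .found 0 ≤ 1
  sound : iv s .found 0 = 1 → I.IsYes
  complete : I.IsYes → iv s .found 0 = 1 ∨ ∃ v ∈ (queue s).drop (iv s .head 0), Good I v

theorem encode_weight (p : ℕ) (hp : p < I.n) : I.encode.int (4 + p) = weightOf I p := by
  simp [EEOInstance.encode, weightOf, hp, show 4 + p ≠ 1 by omega, show 4 + p ≠ 2 by omega,
    show 4 + p ≠ 3 by omega]

theorem encode_stores : Stores I.encode (pointDist I) := by
  intro x hx y hy
  rw [show I.encode.int 0 = I.n from rfl] at hx hy ⊢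
  have h1 : (x * I.n + y) / I.n = x := by
    rw [mul_comm, Nat.mul_add_div (by omega), Nat.div_eq_of_lt hy, add_zero]
  have h2 : (x * I.n + y) % I.n = y := by
    rw [mul_comm, Nat.mul_add_mod, Nat.mod_eq_of_lt hy]
  simp [EEOInstance.encode, pointDist, h1, h2]

theorem iv_encode (a : Var) (i : ℕ) : iv I.encode a i = 0 := by
  have hn : I.encode.int 0 = I.n := rfl
  rw [iv, slot, hn]
  simp only [EEOInstance.encode]
  rw [if_neg (by omega), if_neg (by omega), if_neg (by omega), if_neg (by omega),
    dif_neg (by omega)]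

theorem loopInv_init : LoopInv I (initTables.run I.encode) ∧
    queue (initTables.run I.encode) = [(0, 0)] ∧ iv (initTables.run I.encode) .head 0 = 0 := by
  have hn : I.encode.int 0 = I.n := rfl
  obtain ⟨h1, h2, h3⟩ := initTables_spec (iv_encode I)
  have hf := frame_run initTables I.encode
  have hh : queue (initTables.run I.encode) = [(0, 0)] := by
    simp [queue, h2, h3 .maskQ rfl, h3 .forcedQ rfl]
  have hhead := h3 .head rfl 0
  have hfound := h3 .found rfl 0
  refine ⟨⟨fun j hj => hf.int_of_lt j hj, h1, ?_, by omega, ?_, by omega, by omega, ?_⟩, hh, hhead⟩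
  · exact (encode_stores I).of_eq hf.int_zero fun a _ => by rw [hf.real_eq rfl]
  · rw [hh]
    simp
  · intro h
    right
    rw [hh, hhead]
    exact ⟨(0, 0), by simp, good_root I h⟩

theorem drop_queue {s : State} (h : iv s .head 0 < iv s .tail 0) :
    (queue s).drop (iv s .head 0) =
      (iv s .maskQ (iv s .head 0), iv s .forcedQ (iv s .head 0)) ::
        (queue s).drop (iv s .head 0 + 1) := by
  have hl : iv s .head 0 < (queue s).length := by simpa [queue] using h
  rw [List.drop_eq_getElem_cons hl]
  simp [queue]

theorem length_queue (s : State) : (queue s).length = iv s .tail 0 := by simp [queue]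

theorem kill_lt {n mask q : ℕ} (hm : mask < 2 ^ n) (hq : q < n) (hd : mask.testBit q = false) :
    mask + 2 ^ q < 2 ^ n := by
  apply Nat.lt_pow_two_of_testBit
  intro i hi
  rw [testBit_add_two_pow hd,
    Nat.testBit_lt_two_pow (hm.trans_le (Nat.pow_le_pow_right two_pos hi))]
  simp
  omega

/-- A round preserves the invariant and decreases the total potential of the pending nodes. -/
theorem loopInv_step {s : State} (hI : LoopInv I s) (hh : iv s .head 0 < iv s .tail 0)
    (hfound : iv s .found 0 = 0) :
    LoopInv I (processNode.run s) ∧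
      (((queue (processNode.run s)).drop (iv (processNode.run s) .head 0)).map
        (potential I)).sum + 1 ≤ (((queue s).drop (iv s .head 0)).map (potential I)).sum := by
  have hn : s.int 0 = I.n := hI.int_eq 0 (by omega)
  have hk : s.int 1 = I.k := hI.int_eq 1 (by omega)
  have hd : s.int 2 = I.d := hI.int_eq 2 (by omega)
  have hW : s.int 3 = I.W := hI.int_eq 3 (by omega)
  obtain ⟨mask, hmask⟩ : ∃ m, iv s .maskQ (iv s .head 0) = m := ⟨_, rfl⟩
  obtain ⟨f, hf⟩ : ∃ m, iv s .forcedQ (iv s .head 0) = m := ⟨_, rfl⟩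
  have hdrop := drop_queue hh
  rw [hmask, hf] at hdrop
  have hlt : mask < 2 ^ I.n := hI.mask_lt (mask, f) (List.mem_of_mem_drop
    (hdrop ▸ List.mem_cons_self .. : (mask, f) ∈ (queue s).drop (iv s .head 0)))
  have hw : (∑ p ∈ Finset.range (s.int 0), if mask.testBit p then s.int (4 + p) else 0) =
      ∑ i ∈ deleted I mask, I.weight i := by
    rw [← weight_deleted, hn]
    refine Finset.sum_congr rfl fun p hp => ?_
    have hp := Finset.mem_range.1 hp
    rw [hI.int_eq _ (by omega), encode_weight I p hp]
  obtain ⟨g1, g2, g3⟩ := processNode_spec hI.tables hI.stores hh hmask hf (hn ▸ hlt) hfound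
    (E := nodeElim I mask) (c := (deleted I mask).card) (by rw [hd, hn, nodeElim])
    (by rw [hn]; exact card_deleted I mask) hw
  have hfr := frame_run processNode s
  set s' := processNode.run s
  have hint : ∀ j < I.n + 4, s'.int j = I.encode.int j := fun j hj => by
    rw [hfr.int_of_lt j (by omega), hI.int_eq j hj]
  have hT := hI.tables.frame hfr rfl rfl
  rw [hn, hk, hW] at g3
  rw [g2, hdrop, List.map_cons, List.sum_cons]
  have hpos := potential_pos I (mask, f)
  have hlen : iv s .head 0 + 1 ≤ (queue s).length := by rw [length_queue]; omega
  rcases g3 with ⟨hz, hhist, hfd⟩ | ⟨x, hx, y, hy, hxd, hyd, hne, hfd, hhist⟩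
  · rw [hhist]
    refine ⟨⟨hint, hT, g1, ?_, ?_, ?_, ?_, ?_⟩, by omega⟩
    · rw [g2, ← length_queue, hhist]
      exact hlen
    · rw [hhist]
      exact hI.mask_lt
    · rw [hfd]
      split_ifs <;> omega
    · rw [hfd]
      intro h
      by_cases hb : (deleted I mask).card ≤ I.k ∧ ∑ i ∈ deleted I mask, I.weight i ≤ I.W
      · exact isYes_of_res_eq_zero I hz hb.1 hb.2
      · simp [hb] at h
    · intro hyes
      rw [hfd]
      by_cases hb : (deleted I mask).card ≤ I.k ∧ ∑ i ∈ deleted I mask, I.weight i ≤ I.W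
      · left
        rw [if_pos hb]
      · right
        rcases hI.complete hyes with h | ⟨v, hv, hgood⟩
        · omega
        · rw [hdrop] at hv
          rcases List.mem_cons.1 hv with rfl | hv
          · exact absurd (budget_of_good I hgood) hb
          · exact ⟨v, by rw [g2, hhist]; exact hv, hgood⟩
  · set L := if (deleted I mask).card + 1 ≤ I.k then
      children I.n mask f (nodeElim I mask).pivots x y else [] with hL
    have hdrop' : (queue s').drop (iv s .head 0 + 1) = (queue s).drop (iv s .head 0 + 1) ++ L := by
      rw [hhist, List.drop_append_of_le_length hlen]
    refine ⟨⟨hint, hT, g1, ?_, ?_, by omega, by omega, ?_⟩, ?_⟩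
    · rw [g2, ← length_queue, hhist, List.length_append]
      omega
    · intro v hv
      rw [hhist, List.mem_append] at hv
      rcases hv with hv | hv
      · exact hI.mask_lt v hv
      · rw [hL] at hv
        split_ifs at hv
        · obtain ⟨q, hq, hvq⟩ := of_mem_children hv
          rw [hvq]
          rcases hq with hq | rfl | rfl
          · exact kill_lt hlt (lt_and_alive_of_mem_pivots hq).1 (lt_and_alive_of_mem_pivots hq).2
          · exact kill_lt hlt hx hxd
          · exact kill_lt hlt hy hyd
        · simp at hv
    · intro hyes
      right
      rw [g2, hdrop']
      rcases hI.complete hyes with h | ⟨v, hv, hgood⟩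
      · omega
      · rw [hdrop] at hv
        rcases List.mem_cons.1 hv with rfl | hv
        · obtain ⟨hc, v, hv, hgv⟩ := exists_good_child I hgood hx hy hxd hyd hne
          exact ⟨v, List.mem_append_right _ (by rw [hL, if_pos hc]; exact hv), hgv⟩
        · exact ⟨v, List.mem_append_left _ hv, hgood⟩
    · rw [hdrop', List.map_append, List.sum_append, hL]
      split_ifs with hc
      · have := potential_children I hx hy hxd hyd hc (f := f)
        omega
      · simp
        omega

theorem pending_holds (s : State) :
    pending.Holds s ↔ iv s .head 0 < iv s .tail 0 ∧ iv s .found 0 = 0 := by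
  simp [pending, isZero, Test.Holds, IExp.eval]

/-- The number of rounds is at most the total potential of the pending nodes. -/
theorem exec_loop (N : ℕ) {s : State} (hI : LoopInv I s)
    (hN : (((queue s).drop (iv s .head 0)).map (potential I)).sum ≤ N) :
    ∃ t s', Exec (.loop pending processNode.compile) s t s' ∧ LoopInv I s' ∧ ¬ pending.Holds s' ∧
      t ≤ N * (pending.cost + 1 + processNode.coeff * (I.n + 1) ^ processNode.depth) +
        (pending.cost + 1) := by
  induction N generalizing s with
  | zero =>
    have hp : ¬ pending.Holds s := by
      rw [pending_holds]
      rintro ⟨h1, -⟩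
      rw [drop_queue h1, List.map_cons, List.sum_cons] at hN
      have := potential_pos I (iv s .maskQ (iv s .head 0), iv s .forcedQ (iv s .head 0))
      omega
    exact ⟨_, s, .loop_done hp, hI, hp, by omega⟩
  | succ N ih =>
    by_cases hp : pending.Holds s
    · obtain ⟨h1, h2⟩ := (pending_holds s).1 hp
      obtain ⟨hI', hle⟩ := loopInv_step I hI h1 h2
      obtain ⟨t, s', he, hi, hnp, ht⟩ := ih hI' (by omega)
      obtain ⟨t', he', ht'⟩ := exec_compile processNode rfl s
      rw [show s.int 0 = I.n from hI.int_eq 0 (by omega)] at ht'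
      refine ⟨_, s', .loop_step hp he' he, hi, hnp, ?_⟩
      rw [add_mul, one_mul]
      omega
    · exact ⟨_, s, .loop_done hp, hI, hp, by omega⟩

theorem potential_root : potential I (0, 0) ≤
    2 * (I.n + 1) * min ((I.d + 3) ^ I.k) (2 ^ (I.d + I.k)) := by
  have h : potential I (0, 0) =
      (I.n + 1) * min ((I.d + 3) ^ I.k) (2 * 2 ^ (I.d + I.k)) := by
    rw [potential, deleted_zero, Finset.card_empty, Nat.sub_zero, Nat.sub_zero, Nat.sub_zero,
      show I.k + (I.d + 1) = I.d + I.k + 1 by omega, pow_succ, mul_comm _ 2]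
  rw [h, mul_assoc 2, mul_left_comm 2]
  refine Nat.mul_le_mul_left _ ?_
  rw [← Nat.mul_min_mul_left]
  exact min_le_min_right _ (by omega)

end Instance

end EEO

open EEO RealRAM Block in
theorem theorem5p1 :
    ∃ (P : RealRAM.Prog) (c : ℕ), ∀ I : EEOInstance,
      P.SolvesWithin I
        (c * (I.n + 1) ^ c * min ((I.d + 3) ^ I.k) (2 ^ (I.d + I.k))) := by
  set q := pending.cost + 1 with hq
  set r := (IExp.const 0).cost + (sca .found).cost + 1 with hr
  refine ⟨program, initTables.coeff + 2 * (q + processNode.coeff) + q + r +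
    (initTables.depth + processNode.depth + 1), fun I => ?_⟩
  obtain ⟨hI, hh, hhead⟩ := loopInv_init I
  obtain ⟨t₀, he₀, ht₀⟩ := exec_compile initTables rfl I.encode
  obtain ⟨t₁, s, he₁, hIs, hnp, ht₁⟩ := exec_loop I _ hI le_rfl
  have he₂ := Exec.istore (.const 0) (sca .found) s
  refine ⟨_, _, .seq he₀ (.seq he₁ he₂), ?_, ?_, ?_⟩
  · rw [hh, hhead] at ht₁
    simp only [List.drop_zero, List.map_cons, List.map_nil, List.sum_cons, List.sum_nil,
      add_zero] at ht₁
    rw [show I.encode.int 0 = I.n from rfl] at ht₀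
    rw [← hq] at ht₁
    have hroot := potential_root I
    have hM : 1 ≤ min ((I.d + 3) ^ I.k) (2 ^ (I.d + I.k)) :=
      le_min (Nat.one_le_pow _ _ (by omega)) (Nat.one_le_pow _ _ (by omega))
    generalize min ((I.d + 3) ^ I.k) (2 ^ (I.d + I.k)) = M at hroot hM ⊢
    generalize potential I (0, 0) = Φ at hroot ht₁
    set c := initTables.coeff + 2 * (q + processNode.coeff) + q + r +
      (initTables.depth + processNode.depth + 1) with hc
    have hn : 0 < I.n + 1 := by omega
    have hYM : (I.n + 1) ^ c ≤ (I.n + 1) ^ c * M := Nat.le_mul_of_pos_right _ hM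
    have hone : 1 ≤ (I.n + 1) ^ c * M := Nat.mul_pos (by positivity) hM
    have b₀ : t₀ ≤ initTables.coeff * ((I.n + 1) ^ c * M) :=
      ht₀.trans (Nat.mul_le_mul_left _ ((Nat.pow_le_pow_right hn (by omega)).trans hYM))
    have b₁ : Φ * (q + processNode.coeff * (I.n + 1) ^ processNode.depth) ≤
        2 * (q + processNode.coeff) * ((I.n + 1) ^ c * M) := by
      have h1 : q + processNode.coeff * (I.n + 1) ^ processNode.depth ≤
          (q + processNode.coeff) * (I.n + 1) ^ processNode.depth := by
        rw [add_mul]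
        exact Nat.add_le_add_right (Nat.le_mul_of_pos_right _ (by positivity)) _
      calc _ ≤ 2 * (I.n + 1) * M * ((q + processNode.coeff) * (I.n + 1) ^ processNode.depth) :=
            Nat.mul_le_mul hroot h1
        _ = 2 * (q + processNode.coeff) * ((I.n + 1) ^ (processNode.depth + 1) * M) := by ring
        _ ≤ _ := Nat.mul_le_mul_left _
            (Nat.mul_le_mul_right _ (Nat.pow_le_pow_right hn (by omega)))
    have b₂ : q + r ≤ (q + r) * ((I.n + 1) ^ c * M) := Nat.le_mul_of_pos_right _ hone
    have b₃ : (initTables.coeff + 2 * (q + processNode.coeff) + (q + r)) * ((I.n + 1) ^ c * M) ≤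
        c * ((I.n + 1) ^ c * M) := Nat.mul_le_mul_right _ (by omega)
    rw [add_mul, add_mul] at b₃
    rw [mul_assoc]
    omega
  · intro hyes
    simp only [IExp.eval, Function.update_self, eval_sca]
    rcases hIs.complete hyes with h | ⟨v, hv, -⟩
    · exact h
    · by_contra hne
      have hle := hIs.found_le
      refine hnp ((pending_holds s).2 ⟨?_, by omega⟩)
      have := List.length_pos_of_mem hv
      rw [List.length_drop, length_queue] at this
      omega
  · intro hno
    simp only [IExp.eval, Function.update_self, eval_sca]
    have hle := hIs.found_le
    by_contra hne
    exact hno (hIs.sound (by omega))
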